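/- For a partition $\lambda=(\lambda_1\ge\lambda_2\ge\dots\ge\lambda_\ell)$ of $n$ let $\mathrm{srp}(\lambda):=\sum_{j=1}^{\ell}\frac{1}{\lambda_j}$ be the sum of the reciprocals of its parts, let $\mathcal D_n$ be the set of partitions of $n$ into distinct parts, and let \[ s_1(n):=\sum_{\lambda\in\mathcal D_n}\mathrm{srp}(\lambda). \] Then, as $n\to\infty$ through the positive integers, \[ s_1(n)=\frac{e^{\pi\sqrt{n/3}}}{16\cdot 3^{1/4}\,n^{3/4}}\left(\log(3n)+\left(\frac{\pi}{6}-\frac{9}{\pi}\right)\frac{\log(3n)}{8\sqrt{3n}}+\left(\frac{\pi}{4}+\frac{6}{\pi}\right)\frac{1}{\sqrt{3n}}+O\left(\frac{\log n}{n}\right)\right). \] -/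

import Mathlib

open Filter Asymptotics

noncomputable section

/-- The reciprocal sum `∑ⱼ 1 / λⱼ` over the parts (with multiplicity) of a partition `λ` of `n`. -/
def srp {n : ℕ} (lam : Nat.Partition n) : ℝ :=
  (lam.parts.map fun a : ℕ => 1 / (a : ℝ)).sum

/-- The sum of the reciprocal sums of all partitions of `n` into distinct parts. -/
def s1 (n : ℕ) : ℝ :=
  ∑ lam ∈ Nat.Partition.distincts n, srp lam

end

/-!
With `q = exp (-t)`, the generating function of `s1` is
`∏ₘ (1 + q ^ m) * ∑ₘ q ^ m / (m (1 + q ^ m))`. Both factors are governed by the single function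
`logEuler t = -∑ₘ log (1 - q ^ m)`: the product is `exp (logEuler t - logEuler (2 t))`, and the sum
is `logEuler t - 2 logEuler (2 t)`, because interchanging the summations in
`∑ₘ ∑ₖ q ^ (m k) / k` turns `logEuler t` into `∑ₘ q ^ m / (m (1 - q ^ m))`. The derivative of
`logEuler` is `(E₂ - 1) / 24`, so the inversion formula of `E₂` integrates to one relating
`logEuler t` to `logEuler (4 π ^ 2 / t)` (`logEuler_inversion`). Hence in the cone `|im t| ≤ re t`
the generating function is, up to a factor and a summand that are exponentially close to `1` and
`0`, equal to
`exp (π ^ 2 / (12 t) + t / 24) / √2 * (log (π / (2 t)) / 2 + t / 8)` (`norm_recipGen_sub_main_le`).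

`s1 n` is the integral of the generating function over a circle `re t = c` (`s1_eq_integral`),
obtained from the polynomial generating functions of the truncated problem by dominated
convergence. Write `N = n + 1 / 24`, let `t₀ = π / (2 √(3 N))` be the saddle point of
`π ^ 2 / (12 t) + N t`, let `X = N t₀`, and take `c = t₀ / √2`. For `|im t| ≥ c` comparing the
factors `1 + q ^ m` with their absolute values saves enough
(`norm_recipGen_le_of_minor_arc`). The remaining segment has the same end points as the arc
`t = t₀ exp (i φ)`, `|φ| ≤ π / 4`, on which the exponent is the real number `2 X cos φ`. After taking
real parts (`abs_s1_sub_saddle_le`), Laplace's method with two terms, carried out for the phase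
`2 X (cos φ - 1)` in `laplace_cos`, gives the expansion in powers of `1 / √N`. Replacing `N` by `n`
multiplies it by `1 + π / (48 √(3 n)) + O(1 / n)` (`abs_prefactor_ratio_sub_le`).
-/

/-! ### The coefficient integral of the truncated generating function -/

/-- A partition of `n` into distinct parts is a finite set of positive integers with sum `n`. -/
lemma s1_eq_sum_powerset {n N : ℕ} (h : n ≤ N) :
    s1 n = ∑ S ∈ (Finset.Icc 1 N).powerset with ∑ m ∈ S, m = n, ∑ m ∈ S, 1 / (m : ℝ) := by
  unfold s1
  refine Finset.sum_bij' (fun lam _ => lam.parts.toFinset)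
    (fun S hS => ⟨S.val, fun {i} hi => ?_, ?_⟩) ?_ ?_ ?_ ?_ ?_
  · have := (Finset.mem_filter.1 hS).1
    exact (Finset.mem_Icc.1 (Finset.mem_powerset.1 this hi)).1
  · have := (Finset.mem_filter.1 hS).2
    rw [Finset.sum, Multiset.map_id'] at this
    exact this
  · intro lam hlam
    have hnd : lam.parts.Nodup := (Finset.mem_filter.1 hlam).2
    rw [Finset.mem_filter, Finset.mem_powerset]
    refine ⟨fun i hi => ?_, ?_⟩
    · rw [Multiset.mem_toFinset] at hi
      exact Finset.mem_Icc.2 ⟨lam.parts_pos hi, (Multiset.le_sum_of_mem hi).trans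
        (lam.parts_sum.le.trans h)⟩
    · rw [Finset.sum, Multiset.toFinset_val, hnd.dedup, Multiset.map_id', lam.parts_sum]
  · intro S hS
    exact Finset.mem_filter.2 ⟨Finset.mem_univ _, S.nodup⟩
  · intro lam hlam
    have hnd : lam.parts.Nodup := (Finset.mem_filter.1 hlam).2
    ext1
    simp [hnd.dedup]
  · intro S hS
    simp
  · intro lam hlam
    have hnd : lam.parts.Nodup := (Finset.mem_filter.1 hlam).2
    rw [Finset.sum, Multiset.toFinset_val, hnd.dedup]
    rfl

/-- The logarithmic-derivative form of the generating polynomial of reciprocal sums over the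
subsets of a finite set of parts. -/
lemma sum_powerset_recip_mul_pow (s : Finset ℕ) (q : ℂ) (hq : ∀ m ∈ s, 1 + q ^ m ≠ 0) :
    ∑ S ∈ s.powerset, (∑ m ∈ S, 1 / (m : ℂ)) * q ^ (∑ m ∈ S, m) =
      (∏ m ∈ s, (1 + q ^ m)) * ∑ m ∈ s, 1 / (m : ℂ) * (q ^ m / (1 + q ^ m)) := by
  induction s using Finset.induction_on with
  | empty => simp
  | insert a s ha ih =>
    have ih := ih fun m hm => hq m (Finset.mem_insert_of_mem hm)
    have ha' := hq a (Finset.mem_insert_self _ _)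
    have h1 : ∏ m ∈ s, (1 + q ^ m) = ∑ S ∈ s.powerset, q ^ (∑ m ∈ S, m) := by
      rw [Finset.prod_one_add]
      exact Finset.sum_congr rfl fun S _ => Finset.prod_pow_eq_pow_sum _ _ _
    have h2 : ∀ S ∈ s.powerset, (∑ m ∈ insert a S, 1 / (m : ℂ)) * q ^ (∑ m ∈ insert a S, m) =
        q ^ a * ((∑ m ∈ S, 1 / (m : ℂ)) * q ^ (∑ m ∈ S, m)) +
          1 / (a : ℂ) * q ^ a * q ^ (∑ m ∈ S, m) := by
      intro S hS
      have haS : a ∉ S := fun h => ha (Finset.mem_powerset.1 hS h)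
      rw [Finset.sum_insert haS, Finset.sum_insert haS, pow_add]
      ring
    rw [Finset.sum_powerset_insert ha, Finset.sum_congr rfl h2, Finset.sum_add_distrib,
      ← Finset.mul_sum, ← Finset.mul_sum, ih, ← h1, Finset.prod_insert ha, Finset.sum_insert ha]
    field_simp
    ring

lemma integral_exp_int_mul_I (k : ℤ) :
    ∫ θ in (-Real.pi)..Real.pi, Complex.exp (k * θ * Complex.I) =
      if k = 0 then 2 * (Real.pi : ℂ) else 0 := by
  split_ifs with hk
  · subst hk
    simp [two_mul]
  · have hc : (k : ℂ) * Complex.I ≠ 0 := by simp [hk]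
    have h := integral_exp_mul_complex (a := -Real.pi) (b := Real.pi) hc
    have e : ∀ θ : ℝ, (k : ℂ) * θ * Complex.I = (k : ℂ) * Complex.I * θ := fun θ => by ring
    simp only [e]
    rw [h, div_eq_zero_iff]
    left
    rw [sub_eq_zero, Complex.exp_eq_exp_iff_exists_int]
    exact ⟨k, by push_cast; ring⟩

/-- Cauchy's coefficient formula for the generating polynomial of the partitions into distinct
parts of size at most `N`, on the circle of radius `exp (-c)`. -/
lemma s1_eq_integral_finite {n N : ℕ} (h : n ≤ N) (c : ℝ) (hc : 0 < c) :
    (s1 n : ℂ) = 1 / (2 * Real.pi) * ∫ θ in (-Real.pi)..Real.pi,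
      (∏ m ∈ Finset.Icc 1 N, (1 + Complex.exp (-(c + θ * Complex.I)) ^ m)) *
      (∑ m ∈ Finset.Icc 1 N, 1 / (m : ℂ) * (Complex.exp (-(c + θ * Complex.I)) ^ m /
        (1 + Complex.exp (-(c + θ * Complex.I)) ^ m))) *
      Complex.exp (n * (c + θ * Complex.I)) := by
  have hne : ∀ θ : ℝ, ∀ m ∈ Finset.Icc 1 N,
      1 + Complex.exp (-(c + θ * Complex.I)) ^ m ≠ 0 := by
    intro θ m hm h0
    have h1 : Complex.exp (-(c + θ * Complex.I)) ^ m = -1 := by linear_combination h0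
    have h2 := congrArg norm h1
    rw [norm_pow, Complex.norm_exp, norm_neg, norm_one] at h2
    have h3 : Real.exp (-(c + θ * Complex.I : ℂ)).re < 1 := by
      rw [Real.exp_lt_one_iff]; simpa using hc
    have h4 := pow_lt_one₀ (Real.exp_pos _).le h3 (Nat.one_le_iff_ne_zero.1 (Finset.mem_Icc.1 hm).1)
    exact absurd h2 h4.ne
  have hint : ∀ θ : ℝ, (∏ m ∈ Finset.Icc 1 N, (1 + Complex.exp (-(c + θ * Complex.I)) ^ m)) *
      (∑ m ∈ Finset.Icc 1 N, 1 / (m : ℂ) * (Complex.exp (-(c + θ * Complex.I)) ^ m /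
        (1 + Complex.exp (-(c + θ * Complex.I)) ^ m))) *
      Complex.exp (n * (c + θ * Complex.I)) =
      ∑ S ∈ (Finset.Icc 1 N).powerset, ((∑ m ∈ S, 1 / (m : ℂ)) *
        Complex.exp (((n : ℤ) - (∑ m ∈ S, m : ℕ) : ℤ) * c)) *
        Complex.exp (((n : ℤ) - (∑ m ∈ S, m : ℕ) : ℤ) * θ * Complex.I) := by
    intro θ
    rw [← sum_powerset_recip_mul_pow _ _ (hne θ), Finset.sum_mul]
    refine Finset.sum_congr rfl fun S _ => ?_
    rw [← Complex.exp_nat_mul, mul_assoc, mul_assoc, ← Complex.exp_add, ← Complex.exp_add]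
    congr 2
    push_cast
    ring
  simp only [hint]
  rw [intervalIntegral.integral_finsetSum]
  swap
  · intro S _
    apply Continuous.intervalIntegrable
    fun_prop
  simp only [intervalIntegral.integral_const_mul, integral_exp_int_mul_I]
  have hpi : (Real.pi : ℂ) ≠ 0 := by exact_mod_cast Real.pi_ne_zero
  rw [s1_eq_sum_powerset h, Finset.sum_filter, Finset.mul_sum]
  push_cast
  refine Finset.sum_congr rfl fun S _ => ?_
  by_cases hS : ∑ m ∈ S, m = n
  · have : ((n : ℤ) - ((∑ m ∈ S, m : ℕ) : ℤ)) = 0 := by rw [hS]; simp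
    push_cast at this
    rw [if_pos hS, if_pos this]
    have t2 : (n : ℂ) - ∑ m ∈ S, (m : ℂ) = 0 := by
      have h3 := congrArg (Int.cast : ℤ → ℂ) this
      push_cast at h3
      exact h3
    rw [t2]
    field_simp
    simp
  · have : ¬ ((n : ℤ) - (∑ m ∈ S, (m : ℤ))) = 0 := by
      intro h; apply hS; zify; linarith
    rw [if_neg hS, if_neg this]
    simp

/-! ### The inversion formula for the logarithm of the Euler product -/

/-- The logarithm `-∑ₘ log (1 - q ^ m)`, `m ≥ 1`, of the generating function of all partitions, as
a function of `t` where `q = exp (-t)` and `0 < re t`. -/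
noncomputable def logEuler (t : ℂ) : ℂ :=
  ∑' m : ℕ, -Complex.log (1 - Complex.exp (-t) ^ (m + 1))

lemma norm_exp_neg_lt_one {t : ℂ} (ht : 0 < t.re) : ‖Complex.exp (-t)‖ < 1 := by
  rw [Complex.norm_exp, Real.exp_lt_one_iff]
  simpa using ht

lemma norm_pow_succ_lt_one {q : ℂ} (hq : ‖q‖ < 1) (m : ℕ) : ‖q ^ (m + 1)‖ < 1 := by
  rw [norm_pow]
  exact pow_lt_one₀ (norm_nonneg _) hq (Nat.succ_ne_zero m)

lemma norm_lambert_term_le {q : ℂ} (hq : ‖q‖ < 1) (p : ℕ × ℕ) :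
    ‖q ^ ((p.1 + 1) * (p.2 + 1)) / ((p.2 : ℂ) + 1)‖ ≤ ‖q‖ * (‖q‖ ^ p.1 * ‖q‖ ^ p.2) := by
  have h1 : (1 : ℝ) ≤ ‖((p.2 : ℂ) + 1)‖ := by
    have : ((p.2 : ℂ) + 1) = ((p.2 + 1 : ℕ) : ℂ) := by push_cast; ring
    rw [this, Complex.norm_natCast]
    exact_mod_cast Nat.succ_le_succ (Nat.zero_le _)
  rw [norm_div, norm_pow, ← pow_add, ← pow_succ']
  refine (div_le_self (by positivity) h1).trans ?_
  exact pow_le_pow_of_le_one (norm_nonneg _) hq.le (by nlinarith [Nat.zero_le (p.1 * p.2)])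

lemma hasSum_geometric_prod {r : ℝ} (h0 : 0 ≤ r) (h1 : r < 1) :
    HasSum (fun p : ℕ × ℕ => r * (r ^ p.1 * r ^ p.2)) (r * ((1 - r)⁻¹ * (1 - r)⁻¹)) := by
  refine HasSum.mul_left r ?_
  have hg := hasSum_geometric_of_lt_one h0 h1
  exact hg.mul hg (hg.summable.mul_of_nonneg hg.summable (fun _ => pow_nonneg h0 _)
    (fun _ => pow_nonneg h0 _))

lemma summable_lambert {q : ℂ} (hq : ‖q‖ < 1) :
    Summable fun p : ℕ × ℕ => q ^ ((p.1 + 1) * (p.2 + 1)) / ((p.2 : ℂ) + 1) :=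
  Summable.of_norm_bounded (hasSum_geometric_prod (norm_nonneg q) hq).summable
    (norm_lambert_term_le hq)

lemma hasSum_log_row {q : ℂ} (hq : ‖q‖ < 1) (m : ℕ) :
    HasSum (fun k : ℕ => q ^ ((m + 1) * (k + 1)) / ((k : ℂ) + 1))
      (-Complex.log (1 - q ^ (m + 1))) := by
  have h := Complex.hasSum_taylorSeries_neg_log (norm_pow_succ_lt_one hq m)
  rw [← hasSum_nat_add_iff' 1] at h
  simpa [← pow_mul] using h

lemma hasSum_geom_column {q : ℂ} (hq : ‖q‖ < 1) (k : ℕ) :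
    HasSum (fun m : ℕ => q ^ ((m + 1) * (k + 1)) / ((k : ℂ) + 1))
      (1 / ((k : ℂ) + 1) * (q ^ (k + 1) / (1 - q ^ (k + 1)))) := by
  have h := (hasSum_geometric_of_norm_lt_one (norm_pow_succ_lt_one hq k)).mul_left
    (1 / ((k : ℂ) + 1) * q ^ (k + 1))
  have e1 : (fun m : ℕ => q ^ ((m + 1) * (k + 1)) / ((k : ℂ) + 1)) =
      fun m : ℕ => 1 / ((k : ℂ) + 1) * q ^ (k + 1) * (q ^ (k + 1)) ^ m := by
    ext m
    rw [← pow_mul, add_mul, pow_add, one_mul, mul_comm m (k + 1)]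
    ring
  rw [e1, mul_div_assoc', div_eq_mul_inv]
  exact h

lemma hasSum_lambert {t : ℂ} (ht : 0 < t.re) :
    HasSum (fun p : ℕ × ℕ => Complex.exp (-t) ^ ((p.1 + 1) * (p.2 + 1)) / ((p.2 : ℂ) + 1))
      (logEuler t) := by
  have hq := norm_exp_neg_lt_one ht
  have h := (summable_lambert hq).hasSum
  have h2 := h.prod_fiberwise (hasSum_log_row hq)
  have : logEuler t = _ := h2.tsum_eq
  rw [this]
  exact h

lemma hasSum_logEuler {t : ℂ} (ht : 0 < t.re) :
    HasSum (fun m : ℕ => -Complex.log (1 - Complex.exp (-t) ^ (m + 1))) (logEuler t) :=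
  (hasSum_lambert ht).prod_fiberwise (hasSum_log_row (norm_exp_neg_lt_one ht))

/-- Summing the double series of `logEuler` over the other index first. -/
lemma hasSum_logEuler_recip {t : ℂ} (ht : 0 < t.re) :
    HasSum (fun k : ℕ => 1 / ((k : ℂ) + 1) *
      (Complex.exp (-t) ^ (k + 1) / (1 - Complex.exp (-t) ^ (k + 1)))) (logEuler t) := by
  have h := (Equiv.prodComm ℕ ℕ).hasSum_iff.2 (hasSum_lambert ht)
  exact h.prod_fiberwise (hasSum_geom_column (norm_exp_neg_lt_one ht))

lemma norm_logEuler_le {t : ℂ} (ht : 1 ≤ t.re) : ‖logEuler t‖ ≤ 4 * Real.exp (-t.re) := by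
  have ht0 : 0 < t.re := by linarith
  have hq := norm_exp_neg_lt_one ht0
  have h := tsum_of_norm_bounded (hasSum_geometric_prod (norm_nonneg _) hq)
    (norm_lambert_term_le hq)
  rw [(hasSum_lambert ht0).tsum_eq] at h
  have hr : ‖Complex.exp (-t)‖ = Real.exp (-t.re) := by rw [Complex.norm_exp, Complex.neg_re]
  rw [hr] at h
  have hhalf : Real.exp (-t.re) ≤ 1 / 2 := by
    have : Real.exp (-t.re) ≤ Real.exp (-1) := Real.exp_le_exp.2 (by linarith)
    have h2 := Real.exp_neg_one_lt_half
    linarith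
  have hinv : (1 - Real.exp (-t.re))⁻¹ ≤ 2 := by
    rw [inv_le_comm₀ (by linarith) (by norm_num)]; linarith
  have hinv0 : 0 ≤ (1 - Real.exp (-t.re))⁻¹ := inv_nonneg.2 (by linarith)
  have hp := Real.exp_pos (-t.re)
  calc ‖logEuler t‖ ≤ _ := h
    _ ≤ Real.exp (-t.re) * (2 * 2) := by gcongr
    _ = _ := by ring

lemma hasDerivAt_neg_log_one_sub_exp_pow {s : ℂ} (hs : 0 < s.re) (m : ℕ) :
    HasDerivAt (fun s : ℂ => -Complex.log (1 - Complex.exp (-s) ^ (m + 1)))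
      (-(((m : ℂ) + 1) * Complex.exp (-s) ^ (m + 1) / (1 - Complex.exp (-s) ^ (m + 1)))) s := by
  have hq := norm_pow_succ_lt_one (norm_exp_neg_lt_one hs) m
  have hslit : 1 - Complex.exp (-s) ^ (m + 1) ∈ Complex.slitPlane := by
    have := Complex.mem_slitPlane_of_norm_lt_one (z := -Complex.exp (-s) ^ (m + 1))
      (by rwa [norm_neg])
    rwa [← sub_eq_add_neg] at this
  have h1 : HasDerivAt (fun y : ℂ => Complex.exp (-y)) (Complex.exp (-s) * -1) s :=
    (hasDerivAt_id s).neg.cexp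
  have h2 := ((h1.fun_pow (m + 1)).const_sub 1).clog hslit
  refine h2.fun_neg.congr_deriv ?_
  push_cast
  rw [pow_succ]
  ring

lemma hasDerivAt_logEuler_tsum {t : ℂ} (ht : 0 < t.re) :
    HasDerivAt logEuler (∑' m : ℕ, -(((m : ℂ) + 1) * Complex.exp (-t) ^ (m + 1) /
      (1 - Complex.exp (-t) ^ (m + 1)))) t := by
  set ε := t.re / 2 with hε
  have hε0 : 0 < ε := by positivity
  set r := Real.exp (-ε) with hr
  have hr1 : r < 1 := by rw [hr, Real.exp_lt_one_iff]; linarith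
  have hr0 : 0 < r := Real.exp_pos _
  have hU : IsOpen {s : ℂ | ε < s.re} := isOpen_lt continuous_const Complex.continuous_re
  have hconv : Convex ℝ {s : ℂ | ε < s.re} := convex_halfSpace_re_gt ε
  have hu : Summable fun m : ℕ => ((m : ℝ) + 1) * r ^ (m + 1) * (1 - r)⁻¹ := by
    refine Summable.mul_right _ ?_
    have := summable_pow_mul_geometric_of_norm_lt_one 1 (r := r)
      (by rwa [Real.norm_of_nonneg hr0.le])
    have h2 := (summable_nat_add_iff 1).2 this
    simpa using h2
  have htU : t ∈ {s : ℂ | ε < s.re} := half_lt_self ht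
  change HasDerivAt (fun s : ℂ => ∑' m : ℕ, -Complex.log (1 - Complex.exp (-s) ^ (m + 1))) _ t
  refine hasDerivAt_tsum_of_isPreconnected
    (g := fun (m : ℕ) (s : ℂ) => -Complex.log (1 - Complex.exp (-s) ^ (m + 1)))
    (g' := fun (m : ℕ) (s : ℂ) => -(((m : ℂ) + 1) * Complex.exp (-s) ^ (m + 1) /
      (1 - Complex.exp (-s) ^ (m + 1)))) hu hU
    hconv.isPreconnected ?_ ?_ htU (hasSum_logEuler ht).summable htU
  · intro m s hs
    exact hasDerivAt_neg_log_one_sub_exp_pow (lt_trans hε0 hs) m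
  · intro m s hs
    have hs' : 0 < s.re := lt_trans hε0 hs
    have hqr : ‖Complex.exp (-s)‖ ≤ r := by
      rw [Complex.norm_exp, hr, Real.exp_le_exp, Complex.neg_re]
      exact neg_le_neg (le_of_lt hs)
    have hp : ‖Complex.exp (-s) ^ (m + 1)‖ ≤ r ^ (m + 1) := by
      rw [norm_pow]; gcongr
    have hp' : r ^ (m + 1) ≤ r := pow_le_of_le_one hr0.le hr1.le (Nat.succ_ne_zero m)
    have hden : 1 - r ≤ ‖1 - Complex.exp (-s) ^ (m + 1)‖ := by
      have := norm_sub_norm_le (1 : ℂ) (Complex.exp (-s) ^ (m + 1))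
      rw [norm_one] at this
      linarith
    have hn : ‖((m : ℂ) + 1)‖ = (m : ℝ) + 1 := by
      have : ((m : ℂ) + 1) = ((m + 1 : ℕ) : ℂ) := by push_cast; ring
      rw [this, Complex.norm_natCast]; push_cast; ring
    rw [norm_neg, norm_div, norm_mul, hn, div_eq_mul_inv]
    have : ‖1 - Complex.exp (-s) ^ (m + 1)‖⁻¹ ≤ (1 - r)⁻¹ :=
      inv_anti₀ (by linarith) hden
    gcongr

/-- The derivative of `logEuler` through the Eisenstein series at `z = i t / (2 π)`, for which
`exp (2 π i z) = exp (-t)`. -/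
lemma hasDerivAt_logEuler {t : ℂ} (ht : 0 < t.re) (z : UpperHalfPlane)
    (hz : (z : ℂ) = Complex.I * t / (2 * Real.pi)) :
    HasDerivAt logEuler ((EisensteinSeries.E2 z - 1) / 24) t := by
  refine (hasDerivAt_logEuler_tsum ht).congr_deriv ?_
  have hpi : (Real.pi : ℂ) ≠ 0 := by exact_mod_cast Real.pi_ne_zero
  have he : Complex.exp (2 * Real.pi * Complex.I * z) = Complex.exp (-t) := by
    rw [hz]
    congr 1
    field_simp
    rw [Complex.I_sq]
    ring
  rw [EisensteinSeries.E2_eq_tsum_cexp, he]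
  rw [← tsum_pow_div_one_sub_eq_tsum_sigma (norm_exp_neg_lt_one ht) 1]
  rw [tsum_pnat_eq_tsum_succ (f := fun n : ℕ => (n : ℂ) ^ 1 * Complex.exp (-t) ^ n /
    (1 - Complex.exp (-t) ^ n)), tsum_neg]
  push_cast
  simp only [pow_one]
  ring

/-- The inversion formula for the weight two Eisenstein series. -/
lemma E2_inversion (z : UpperHalfPlane) :
    EisensteinSeries.E2 (ModularGroup.S • z) =
      (z : ℂ) ^ 2 * EisensteinSeries.E2 z - 6 * Complex.I * z / Real.pi := by
  have h := EisensteinSeries.G2_S_transform z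
  have hz : (z : ℂ) ≠ 0 := UpperHalfPlane.ne_zero z
  have hpi : (Real.pi : ℂ) ≠ 0 := by exact_mod_cast Real.pi_ne_zero
  have h2 : EisensteinSeries.G2 (ModularGroup.S • z) =
      (z : ℂ) ^ 2 * EisensteinSeries.G2 z - 2 * Real.pi * Complex.I * z := by
    rw [h]; field_simp; ring
  simp only [EisensteinSeries.E2, Pi.smul_apply, smul_eq_mul, h2, riemannZeta_two]
  field_simp

/-- The transformation law of `logEuler` under `t ↦ 4 π ^ 2 / t`, that is, the logarithm of the
inversion formula of the Dedekind eta function. -/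
theorem logEuler_inversion {t : ℂ} (ht : 0 < t.re) :
    logEuler t = logEuler (4 * Real.pi ^ 2 / t) + Real.pi ^ 2 / (6 * t) +
      1 / 2 * Complex.log (t / (2 * Real.pi)) - t / 24 := by
  have hpi : (Real.pi : ℂ) ≠ 0 := by exact_mod_cast Real.pi_ne_zero
  have hre : ∀ s : ℂ, 0 < s.re → 0 < (4 * Real.pi ^ 2 / s : ℂ).re := by
    intro s hs
    have e : (4 * Real.pi ^ 2 / s : ℂ) = ((4 * Real.pi ^ 2 : ℝ) : ℂ) * s⁻¹ := by
      push_cast; ring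
    have hs0 : s ≠ 0 := by rintro rfl; simp at hs
    rw [e, Complex.re_ofReal_mul, Complex.inv_re]
    have := Complex.normSq_pos.2 hs0
    positivity
  let U : Set ℂ := {s : ℂ | 0 < s.re}
  let f : ℂ → ℂ := fun s => logEuler s - logEuler (4 * Real.pi ^ 2 / s) -
    (Real.pi ^ 2 / 6 * s⁻¹ + 1 / 2 * Complex.log (s / (2 * Real.pi)) - s / 24)
  have hU : IsOpen U := isOpen_lt continuous_const Complex.continuous_re
  have hconn : IsPreconnected U := (convex_halfSpace_re_gt 0).isPreconnected
  have hf : ∀ s ∈ U, HasDerivAt f 0 s := by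
    intro s hs
    have hs' : 0 < s.re := hs
    have hs0 : s ≠ 0 := by rintro rfl; simp at hs'
    have him : 0 < (Complex.I * s / (2 * Real.pi)).im := by
      have e : Complex.I * s / (2 * Real.pi) = (((2 * Real.pi)⁻¹ : ℝ) : ℂ) * (Complex.I * s) := by
        push_cast; ring
      rw [e, Complex.im_ofReal_mul]
      have := Real.pi_pos
      simp
      positivity
    let z : UpperHalfPlane := ⟨Complex.I * s / (2 * Real.pi), him⟩
    have hz : (z : ℂ) = Complex.I * s / (2 * Real.pi) := rfl
    have hS : ((ModularGroup.S • z : UpperHalfPlane) : ℂ) =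
        Complex.I * (4 * Real.pi ^ 2 / s) / (2 * Real.pi) := by
      rw [UpperHalfPlane.modular_S_smul]
      change (-(z : ℂ))⁻¹ = _
      rw [hz]
      field_simp
      rw [Complex.I_sq]
      ring
    have h1 := hasDerivAt_logEuler hs' z hz
    have h2 := hasDerivAt_logEuler (hre s hs') _ hS
    have hinv := (hasDerivAt_inv hs0)
    have h3 : HasDerivAt (fun s : ℂ => 4 * Real.pi ^ 2 / s) (4 * Real.pi ^ 2 * -(s ^ 2)⁻¹) s := by
      simpa [div_eq_mul_inv] using hinv.const_mul (4 * (Real.pi : ℂ) ^ 2)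
    have h4 := h2.comp s h3
    have hslit : s / (2 * Real.pi) ∈ Complex.slitPlane := by
      left
      have e : s / (2 * Real.pi) = (((2 * Real.pi)⁻¹ : ℝ) : ℂ) * s := by push_cast; ring
      rw [e, Complex.re_ofReal_mul]
      have := Real.pi_pos
      positivity
    have h5 := ((hasDerivAt_id s).div_const (2 * (Real.pi : ℂ))).clog hslit
    have h6 := (h1.sub h4).sub (((hinv.const_mul ((Real.pi : ℂ) ^ 2 / 6)).add
      (h5.const_mul (1 / 2))).sub ((hasDerivAt_id s).div_const 24))
    refine h6.congr_deriv ?_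
    rw [E2_inversion, hz]
    simp only [id]
    field_simp
    rw [Complex.I_sq]
    ring
  have h2pi : (2 * Real.pi : ℂ) ∈ U := by
    change 0 < (2 * Real.pi : ℂ).re
    simp [Real.pi_pos]
  -- The constant of integration is found at the fixed point `t = 2 π` of the inversion.
  have hconst : f t = f (2 * Real.pi) :=
    hU.is_const_of_deriv_eq_zero hconn
      (fun s hs => (hf s hs).differentiableAt.differentiableWithinAt)
      (fun s hs => (hf s hs).deriv) ht h2pi
  have hzero : f (2 * Real.pi) = 0 := by
    have e : (4 * Real.pi ^ 2 / (2 * Real.pi) : ℂ) = 2 * Real.pi := by field_simp; norm_num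
    have e2 : (2 * Real.pi / (2 * Real.pi) : ℂ) = 1 := by field_simp
    simp only [f, e, e2, Complex.log_one]
    field_simp
    ring
  rw [hzero] at hconst
  simp only [f] at hconst
  have hi : (Real.pi : ℂ) ^ 2 / (6 * t) = Real.pi ^ 2 / 6 * t⁻¹ := by
    rw [div_mul_eq_div_div, div_eq_mul_inv]
  rw [hi]
  linear_combination hconst

/-! ### The generating function of `s1` -/

lemma prod_Icc_one_eq_prod_range {M : Type*} [CommMonoid M] (f : ℕ → M) (N : ℕ) :
    ∏ m ∈ Finset.Icc 1 N, f m = ∏ m ∈ Finset.range N, f (m + 1) := by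
  induction N with
  | zero => simp
  | succ N ih => rw [Finset.prod_Icc_succ_top (by omega), ih, Finset.prod_range_succ]

lemma sum_Icc_one_eq_sum_range {M : Type*} [AddCommMonoid M] (f : ℕ → M) (N : ℕ) :
    ∑ m ∈ Finset.Icc 1 N, f m = ∑ m ∈ Finset.range N, f (m + 1) := by
  induction N with
  | zero => simp
  | succ N ih => rw [Finset.sum_Icc_succ_top (by omega), ih, Finset.sum_range_succ]

lemma exp_neg_two_mul (t : ℂ) : Complex.exp (-(2 * t)) = Complex.exp (-t) ^ 2 := by
  rw [← Complex.exp_nat_mul]; congr 1; push_cast; ring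

lemma re_two_mul_pos {t : ℂ} (ht : 0 < t.re) : 0 < (2 * t).re := by
  simpa using ht

lemma one_sub_ne_zero_of_norm_lt_one {x : ℂ} (hx : ‖x‖ < 1) : 1 - x ≠ 0 := by
  intro h
  have : x = 1 := by linear_combination -h
  rw [this, norm_one] at hx
  exact lt_irrefl _ hx

lemma one_add_ne_zero_of_norm_lt_one {x : ℂ} (hx : ‖x‖ < 1) : 1 + x ≠ 0 := by
  have := one_sub_ne_zero_of_norm_lt_one (x := -x) (by rwa [norm_neg])
  rwa [sub_neg_eq_add] at this

/-- The product generating function of partitions into distinct parts. -/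
lemma tendsto_prod_one_add {t : ℂ} (ht : 0 < t.re) :
    Tendsto (fun N : ℕ => ∏ m ∈ Finset.Icc 1 N, (1 + Complex.exp (-t) ^ m)) atTop
      (nhds (Complex.exp (logEuler t - logEuler (2 * t)))) := by
  have h := ((hasSum_logEuler ht).sub (hasSum_logEuler (re_two_mul_pos ht))).tendsto_sum_nat
  refine ((Complex.continuous_exp.tendsto _).comp h).congr fun N => ?_
  rw [Function.comp, Complex.exp_sum, prod_Icc_one_eq_prod_range]
  refine Finset.prod_congr rfl fun m _ => ?_
  have hx := norm_pow_succ_lt_one (norm_exp_neg_lt_one ht) m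
  set x := Complex.exp (-t) ^ (m + 1) with hxdef
  have h2 : Complex.exp (-(2 * t)) ^ (m + 1) = x ^ 2 := by
    rw [exp_neg_two_mul, hxdef, ← pow_mul, ← pow_mul, mul_comm]
  have h1 := one_sub_ne_zero_of_norm_lt_one hx
  have h3 := one_add_ne_zero_of_norm_lt_one hx
  have h4 : 1 - x ^ 2 = (1 - x) * (1 + x) := by ring
  have h5 : 1 - x ^ 2 ≠ 0 := by rw [h4]; exact mul_ne_zero h1 h3
  rw [h2, Complex.exp_sub, Complex.exp_neg, Complex.exp_neg, Complex.exp_log h1,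
    Complex.exp_log h5, h4]
  field_simp

lemma tendsto_sum_recip {t : ℂ} (ht : 0 < t.re) :
    Tendsto (fun N : ℕ => ∑ m ∈ Finset.Icc 1 N, 1 / (m : ℂ) *
      (Complex.exp (-t) ^ m / (1 + Complex.exp (-t) ^ m))) atTop
      (nhds (logEuler t - 2 * logEuler (2 * t))) := by
  have h := ((hasSum_logEuler_recip ht).sub
    ((hasSum_logEuler_recip (re_two_mul_pos ht)).mul_left 2)).tendsto_sum_nat
  refine h.congr fun N => ?_
  rw [sum_Icc_one_eq_sum_range]
  refine Finset.sum_congr rfl fun m _ => ?_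
  have hx := norm_pow_succ_lt_one (norm_exp_neg_lt_one ht) m
  set x := Complex.exp (-t) ^ (m + 1) with hxdef
  have h2 : Complex.exp (-(2 * t)) ^ (m + 1) = x ^ 2 := by
    rw [exp_neg_two_mul, hxdef, ← pow_mul, ← pow_mul, mul_comm]
  have h1 := one_sub_ne_zero_of_norm_lt_one hx
  have h3 := one_add_ne_zero_of_norm_lt_one hx
  have h4 : 1 - x ^ 2 = (1 - x) * (1 + x) := by ring
  have h5 : (m : ℂ) + 1 ≠ 0 := by exact_mod_cast Nat.succ_ne_zero m
  rw [h2, h4]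
  push_cast
  field_simp
  ring

lemma sum_Icc_one_pow_le {r : ℝ} (h0 : 0 ≤ r) (h1 : r < 1) (N : ℕ) :
    ∑ m ∈ Finset.Icc 1 N, r ^ m ≤ (1 - r)⁻¹ := by
  have h := (summable_geometric_of_lt_one h0 h1).sum_le_tsum (Finset.Icc 1 N)
    (fun _ _ => pow_nonneg h0 _)
  rwa [tsum_geometric_of_lt_one h0 h1] at h

lemma norm_prod_one_add_le {q : ℂ} (hq : ‖q‖ < 1) (N : ℕ) :
    ‖∏ m ∈ Finset.Icc 1 N, (1 + q ^ m)‖ ≤ Real.exp ((1 - ‖q‖)⁻¹) := by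
  rw [norm_prod]
  calc ∏ m ∈ Finset.Icc 1 N, ‖1 + q ^ m‖
      ≤ ∏ m ∈ Finset.Icc 1 N, Real.exp (‖q‖ ^ m) := by
        refine Finset.prod_le_prod (fun _ _ => norm_nonneg _) fun m _ => ?_
        refine (norm_add_le _ _).trans ?_
        rw [norm_one, norm_pow, add_comm]
        exact Real.add_one_le_exp _
    _ = Real.exp (∑ m ∈ Finset.Icc 1 N, ‖q‖ ^ m) := (Real.exp_sum _ _).symm
    _ ≤ _ := Real.exp_le_exp.2 (sum_Icc_one_pow_le (norm_nonneg _) hq N)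

lemma norm_sum_recip_le {q : ℂ} (hq : ‖q‖ < 1) (N : ℕ) :
    ‖∑ m ∈ Finset.Icc 1 N, 1 / (m : ℂ) * (q ^ m / (1 + q ^ m))‖ ≤ ((1 - ‖q‖)⁻¹) ^ 2 := by
  have h1 : 0 < 1 - ‖q‖ := by linarith
  calc ‖∑ m ∈ Finset.Icc 1 N, 1 / (m : ℂ) * (q ^ m / (1 + q ^ m))‖
      ≤ ∑ m ∈ Finset.Icc 1 N, ‖q‖ ^ m * (1 - ‖q‖)⁻¹ := by
        refine norm_sum_le_of_le _ fun m hm => ?_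
        have hm1 := (Finset.mem_Icc.1 hm).1
        have hm2 : (1 : ℝ) ≤ m := by exact_mod_cast hm1
        have hpow : ‖q‖ ^ m ≤ ‖q‖ := pow_le_of_le_one (norm_nonneg _) hq.le (by omega)
        have hden : 1 - ‖q‖ ≤ ‖1 + q ^ m‖ := by
          have := norm_sub_norm_le (1 : ℂ) (-q ^ m)
          rw [norm_one, norm_neg, norm_pow, sub_neg_eq_add] at this
          linarith
        rw [norm_mul, norm_div, norm_div, norm_one, Complex.norm_natCast, norm_pow]
        have ha : 1 / (m : ℝ) ≤ 1 := by rw [div_le_one (by linarith)]; exact hm2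
        have hb : ‖q‖ ^ m / ‖1 + q ^ m‖ ≤ ‖q‖ ^ m * (1 - ‖q‖)⁻¹ := by
          rw [div_eq_mul_inv]
          gcongr
        calc 1 / (m : ℝ) * (‖q‖ ^ m / ‖1 + q ^ m‖) ≤ 1 * (‖q‖ ^ m / ‖1 + q ^ m‖) := by gcongr
          _ ≤ _ := by rw [one_mul]; exact hb
    _ = (∑ m ∈ Finset.Icc 1 N, ‖q‖ ^ m) * (1 - ‖q‖)⁻¹ := by rw [Finset.sum_mul]
    _ ≤ (1 - ‖q‖)⁻¹ * (1 - ‖q‖)⁻¹ := by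
        gcongr
        exact sum_Icc_one_pow_le (norm_nonneg _) hq N
    _ = _ := by ring

/-- The generating function of `s1`, as a function of `t` with `q = exp (-t)`: the generating
function of partitions into distinct parts times the sum `∑ₘ q ^ m / (m (1 + q ^ m))`. -/
noncomputable def recipGen (t : ℂ) : ℂ :=
  Complex.exp (logEuler t - logEuler (2 * t)) * (logEuler t - 2 * logEuler (2 * t))

theorem s1_eq_integral (n : ℕ) {c : ℝ} (hc : 0 < c) :
    (s1 n : ℂ) = 1 / (2 * Real.pi) * ∫ θ in (-Real.pi)..Real.pi,
      recipGen (c + θ * Complex.I) * Complex.exp (n * (c + θ * Complex.I)) := by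
  have hre : ∀ θ : ℝ, 0 < (c + θ * Complex.I : ℂ).re := by intro θ; simpa using hc
  have hnorm : ∀ θ : ℝ, ‖Complex.exp (-(c + θ * Complex.I))‖ = Real.exp (-c) := by
    intro θ; rw [Complex.norm_exp]; simp
  let F : ℕ → ℝ → ℂ := fun N θ =>
    (∏ m ∈ Finset.Icc 1 N, (1 + Complex.exp (-(c + θ * Complex.I)) ^ m)) *
      (∑ m ∈ Finset.Icc 1 N, 1 / (m : ℂ) * (Complex.exp (-(c + θ * Complex.I)) ^ m /
        (1 + Complex.exp (-(c + θ * Complex.I)) ^ m))) *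
      Complex.exp (n * (c + θ * Complex.I))
  have hlim : Tendsto (fun N => ∫ θ in (-Real.pi)..Real.pi, F N θ) atTop
      (nhds (∫ θ in (-Real.pi)..Real.pi,
        recipGen (c + θ * Complex.I) * Complex.exp (n * (c + θ * Complex.I)))) := by
    refine intervalIntegral.tendsto_integral_filter_of_dominated_convergence
      (fun _ => Real.exp ((1 - Real.exp (-c))⁻¹) * ((1 - Real.exp (-c))⁻¹) ^ 2 *
        Real.exp (n * c)) ?_ ?_ ?_ ?_
    · refine Eventually.of_forall fun N => Measurable.aestronglyMeasurable ?_
      have : Measurable fun θ : ℝ => Complex.exp (-(c + θ * Complex.I)) :=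
        Continuous.measurable (by fun_prop)
      have h2 : Measurable fun θ : ℝ => Complex.exp (n * (c + θ * Complex.I)) :=
        Continuous.measurable (by fun_prop)
      refine Measurable.mul (Measurable.mul ?_ ?_) h2
      · exact Finset.measurable_fun_prod _ fun m _ => (this.pow_const m).const_add 1
      · exact Finset.measurable_fun_sum _ fun m _ =>
          ((this.pow_const m).div ((this.pow_const m).const_add 1)).const_mul _
    · refine Eventually.of_forall fun N => Eventually.of_forall fun θ _ => ?_
      have hq := norm_exp_neg_lt_one (hre θ)
      have h1 := norm_prod_one_add_le hq N
      have h2 := norm_sum_recip_le hq N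
      rw [hnorm] at h1 h2
      have h3 : ‖Complex.exp (n * (c + θ * Complex.I))‖ = Real.exp (n * c) := by
        rw [Complex.norm_exp]; simp
      simp only [F]
      rw [norm_mul, norm_mul, h3]
      gcongr
    · exact intervalIntegrable_const
    · refine Eventually.of_forall fun θ _ => ?_
      exact ((tendsto_prod_one_add (hre θ)).mul (tendsto_sum_recip (hre θ))).mul_const _
  have hconst : Tendsto (fun _ : ℕ => (s1 n : ℂ)) atTop (nhds (1 / (2 * Real.pi) *
      ∫ θ in (-Real.pi)..Real.pi,
        recipGen (c + θ * Complex.I) * Complex.exp (n * (c + θ * Complex.I)))) := by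
    refine (hlim.const_mul _).congr' ?_
    filter_upwards [eventually_ge_atTop n] with N hN
    exact (s1_eq_integral_finite hN c hc).symm
  exact tendsto_nhds_unique tendsto_const_nhds hconst

/-- With `ρ = ‖x‖`, `‖1 + x‖ ^ 2 = (1 + ρ) ^ 2 - 2 (ρ - re x)`, and `(1 + ρ) ^ 2 ≤ 4`. -/
lemma norm_one_add_le_of_re (x : ℂ) (hx : ‖x‖ < 1) :
    ‖1 + x‖ ≤ (1 + ‖x‖) * Real.exp (-((‖x‖ - x.re) / 4)) := by
  set ρ := ‖x‖ with hρ
  have hρ0 : 0 ≤ ρ := norm_nonneg _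
  have hre : x.re ≤ ρ := Complex.re_le_norm x
  have hsq : ‖1 + x‖ ^ 2 = (1 + ρ) ^ 2 - 2 * (ρ - x.re) := by
    have h1 : ρ ^ 2 = x.re ^ 2 + x.im ^ 2 := by
      rw [hρ, ← Complex.normSq_eq_norm_sq, Complex.normSq_apply]; ring
    rw [← Complex.normSq_eq_norm_sq, Complex.normSq_apply]
    simp
    nlinarith
  have hexp := Real.add_one_le_exp (-((ρ - x.re) / 2))
  have hexp2 : Real.exp (-((ρ - x.re) / 2)) = Real.exp (-((ρ - x.re) / 4)) ^ 2 := by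
    rw [← Real.exp_nat_mul]; congr 1; push_cast; ring
  refine abs_le_of_sq_le_sq' ?_ (by positivity) |>.2
  rw [mul_pow, ← hexp2, hsq]
  have : (1 + ρ) ^ 2 - 2 * (ρ - x.re) ≤ (1 + ρ) ^ 2 * (-((ρ - x.re) / 2) + 1) := by
    have : (1 + ρ) ^ 2 ≤ 4 := by nlinarith
    nlinarith
  exact this.trans (by gcongr)

/-- Off the positive real axis the generating function of partitions into distinct parts is
smaller than on it. -/
lemma norm_exp_logEuler_sub_le {t : ℂ} (ht : 0 < t.re) :
    ‖Complex.exp (logEuler t - logEuler (2 * t))‖ ≤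
      ‖Complex.exp (logEuler t.re - logEuler (2 * t.re))‖ *
        Real.exp (-((1 / (1 - Real.exp (-t.re)) - (1 / (1 - Complex.exp (-t))).re) / 4)) := by
  have hq := norm_exp_neg_lt_one ht
  have hr : ‖Complex.exp (-t)‖ = Real.exp (-t.re) := by rw [Complex.norm_exp, Complex.neg_re]
  have hr' : Complex.exp (-(t.re : ℂ)) = (Real.exp (-t.re) : ℂ) := by push_cast; rfl
  have htre : 0 < (t.re : ℂ).re := by simpa using ht
  set q := Complex.exp (-t) with hqdef
  set r := Real.exp (-t.re) with hrdef
  have hr0 : 0 < r := Real.exp_pos _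
  have hr1 : r < 1 := hr ▸ hq
  have hfin : ∀ N : ℕ, ‖∏ m ∈ Finset.range N, (1 + q ^ (m + 1))‖ ≤
      ‖∏ m ∈ Finset.range N, (1 + (r : ℂ) ^ (m + 1))‖ *
        Real.exp (-((∑ m ∈ Finset.range N, (r ^ (m + 1) - (q ^ (m + 1)).re)) / 4)) := by
    intro N
    rw [Finset.sum_div, ← Finset.sum_neg_distrib, Real.exp_sum, norm_prod, norm_prod,
      ← Finset.prod_mul_distrib]
    refine Finset.prod_le_prod (fun _ _ => norm_nonneg _) fun m _ => ?_
    have h := norm_one_add_le_of_re _ (norm_pow_succ_lt_one hq m)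
    rw [norm_pow, hr] at h
    refine h.trans_eq ?_
    congr 1
    rw [← Complex.ofReal_pow, ← Complex.ofReal_one, ← Complex.ofReal_add, Complex.norm_real,
      Real.norm_of_nonneg (by positivity)]
  have hsumr : HasSum (fun m : ℕ => r ^ (m + 1)) (1 / (1 - r) - 1) := by
    have h := (hasSum_geometric_of_lt_one hr0.le hr1)
    rw [← hasSum_nat_add_iff' 1] at h
    simpa using h
  have hsumq : HasSum (fun m : ℕ => (q ^ (m + 1)).re) ((1 / (1 - q)).re - 1) := by
    have h := (hasSum_geometric_of_norm_lt_one hq)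
    rw [← hasSum_nat_add_iff' 1] at h
    simpa using Complex.hasSum_re h
  have hsum := (hsumr.sub hsumq).tendsto_sum_nat
  have e : 1 / (1 - r) - 1 - ((1 / (1 - q)).re - 1) = 1 / (1 - r) - (1 / (1 - q)).re := by ring
  rw [e] at hsum
  have hA := (tendsto_prod_one_add ht).norm
  have hB := (tendsto_prod_one_add htre).norm
  rw [hr'] at hB
  simp only [prod_Icc_one_eq_prod_range] at hA hB
  exact le_of_tendsto_of_tendsto' hA
    (hB.mul ((Real.continuous_exp.tendsto _).comp (hsum.div_const 4).neg)) hfin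

lemma norm_logEuler_sub_two_mul_le {t : ℂ} (ht : 0 < t.re) :
    ‖logEuler t - 2 * logEuler (2 * t)‖ ≤ ((1 - Real.exp (-t.re))⁻¹) ^ 2 := by
  have h : ∀ N, _ ≤ _ := norm_sum_recip_le (norm_exp_neg_lt_one ht)
  have hr : ‖Complex.exp (-t)‖ = Real.exp (-t.re) := by rw [Complex.norm_exp, Complex.neg_re]
  rw [hr] at h
  exact le_of_tendsto' (tendsto_sum_recip ht).norm h

/-! ### Major and minor arcs -/

/-- The approximation to `recipGen` near `t = 0`: the modular inversion formula with the
exponentially small terms dropped. -/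
noncomputable def recipGenMain (t : ℂ) : ℂ :=
  Complex.exp (Real.pi ^ 2 / (12 * t) + t / 24) / Real.sqrt 2 *
    ((Real.log (Real.pi / 2) - Complex.log t) / 2 + t / 8)

lemma four_pi_sq_div (t : ℂ) : (4 * Real.pi ^ 2 / (2 * t) : ℂ) = 2 * Real.pi ^ 2 / t := by
  rw [show (4 * Real.pi ^ 2 : ℂ) = 2 * (2 * Real.pi ^ 2) by ring, mul_div_mul_left _ _ two_ne_zero]

lemma complex_log_div_real {t : ℂ} (ht : t ≠ 0) {a : ℝ} (ha : 0 < a) :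
    Complex.log (t / a) = Complex.log t - Real.log a := by
  rw [div_eq_mul_inv, ← Complex.ofReal_inv, Complex.log_mul_ofReal _ (inv_pos.2 ha) _ ht,
    Real.log_inv]
  push_cast
  ring

lemma logEuler_sub_logEuler_two_mul {t : ℂ} (ht : 0 < t.re) :
    logEuler t - logEuler (2 * t) = Real.pi ^ 2 / (12 * t) + t / 24 - Real.log 2 / 2 +
      (logEuler (4 * Real.pi ^ 2 / t) - logEuler (2 * Real.pi ^ 2 / t)) := by
  have ht0 : t ≠ 0 := by rintro rfl; simp at ht
  have h1 := logEuler_inversion ht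
  have h2 := logEuler_inversion (re_two_mul_pos ht)
  rw [four_pi_sq_div, mul_div_mul_left _ _ two_ne_zero, complex_log_div_real ht0 Real.pi_pos] at h2
  have e : (2 * Real.pi : ℂ) = ((2 * Real.pi : ℝ) : ℂ) := by push_cast; ring
  rw [e, complex_log_div_real ht0 (by positivity), Real.log_mul two_ne_zero Real.pi_ne_zero] at h1
  rw [h1, h2]
  push_cast
  field_simp
  ring

lemma logEuler_sub_two_mul_logEuler_two_mul {t : ℂ} (ht : 0 < t.re) :
    logEuler t - 2 * logEuler (2 * t) = (Real.log (Real.pi / 2) - Complex.log t) / 2 + t / 8 +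
      (logEuler (4 * Real.pi ^ 2 / t) - 2 * logEuler (2 * Real.pi ^ 2 / t)) := by
  have ht0 : t ≠ 0 := by rintro rfl; simp at ht
  have h1 := logEuler_inversion ht
  have h2 := logEuler_inversion (re_two_mul_pos ht)
  rw [four_pi_sq_div, mul_div_mul_left _ _ two_ne_zero, complex_log_div_real ht0 Real.pi_pos] at h2
  have e : (2 * Real.pi : ℂ) = ((2 * Real.pi : ℝ) : ℂ) := by push_cast; ring
  rw [e, complex_log_div_real ht0 (by positivity), Real.log_mul two_ne_zero Real.pi_ne_zero] at h1
  rw [h1, h2, Real.log_div Real.pi_ne_zero two_ne_zero]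
  push_cast
  field_simp
  ring

lemma exp_neg_half_log_two : Complex.exp (-(Real.log 2 / 2)) = 1 / Real.sqrt 2 := by
  have h : (-(Real.log 2 / 2) : ℂ) = ((-(Real.log 2 / 2) : ℝ) : ℂ) := by push_cast; ring
  rw [h, ← Complex.ofReal_exp, Real.exp_neg, Real.exp_half, Real.exp_log two_pos]
  push_cast
  rw [one_div]

section Cone

variable {t : ℂ} {c : ℝ}

lemma norm_bounds_of_cone (hc : 0 < c) (hre : t.re = c) (him : |t.im| ≤ c) :
    c ≤ ‖t‖ ∧ ‖t‖ ≤ 2 * c ∧ Complex.normSq t ≤ 2 * c ^ 2 := by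
  have h1 : t.im ^ 2 ≤ c ^ 2 := sq_le_sq' (abs_le.1 him).1 (abs_le.1 him).2
  have h2 : Complex.normSq t ≤ 2 * c ^ 2 := by
    rw [Complex.normSq_apply, hre]; nlinarith
  refine ⟨?_, ?_, h2⟩
  · rw [← hre]; exact Complex.re_le_norm t
  · refine (Complex.norm_le_abs_re_add_abs_im t).trans ?_
    rw [hre, abs_of_pos hc]; linarith

lemma re_real_div (a : ℝ) (t : ℂ) : ((a : ℂ) / t).re = a * (t.re / Complex.normSq t) := by
  rw [div_eq_mul_inv, Complex.re_ofReal_mul, Complex.inv_re]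

lemma re_real_div_ge (hc : 0 < c) (hre : t.re = c) (him : |t.im| ≤ c) {a : ℝ} (ha : 0 ≤ a) :
    a / (2 * c) ≤ ((a : ℂ) / t).re := by
  obtain ⟨h1, _, h3⟩ := norm_bounds_of_cone hc hre him
  have hpos : 0 < Complex.normSq t := by
    rw [Complex.normSq_eq_norm_sq]; have := hc.trans_le h1; positivity
  rw [re_real_div, hre, div_eq_mul_inv]
  refine mul_le_mul_of_nonneg_left ?_ ha
  rw [inv_eq_one_div, div_le_div_iff₀ (by positivity) hpos]
  nlinarith

/-- The dual terms of the inversion formula are exponentially small in the cone. -/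
lemma norm_dual_le (hc : 0 < c) (hc1 : c ≤ 1) (hre : t.re = c) (him : |t.im| ≤ c) :
    ‖logEuler (4 * Real.pi ^ 2 / t)‖ ≤ 4 * Real.exp (-(Real.pi ^ 2 / c)) ∧
      ‖logEuler (2 * Real.pi ^ 2 / t)‖ ≤ 4 * Real.exp (-(Real.pi ^ 2 / c)) := by
  have hpi := Real.pi_gt_three
  have hbig : 1 ≤ Real.pi ^ 2 / c := by
    rw [le_div_iff₀ hc]; nlinarith
  have key : ∀ a : ℝ, 2 * Real.pi ^ 2 ≤ a →
      ‖logEuler ((a : ℂ) / t)‖ ≤ 4 * Real.exp (-(Real.pi ^ 2 / c)) := by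
    intro a ha
    have h1 := re_real_div_ge hc hre him (a := a) (by nlinarith)
    have h2 : Real.pi ^ 2 / c ≤ a / (2 * c) := by
      rw [div_le_div_iff₀ hc (by positivity)]; nlinarith
    refine (norm_logEuler_le (by linarith)).trans ?_
    have : Real.exp (-((a : ℂ) / t).re) ≤ Real.exp (-(Real.pi ^ 2 / c)) :=
      Real.exp_le_exp.2 (by linarith)
    linarith
  constructor
  · have := key (4 * Real.pi ^ 2) (by nlinarith)
    push_cast at this; exact this
  · have := key (2 * Real.pi ^ 2) le_rfl
    push_cast at this; exact this

lemma exp_neg_pi_sq_div_le (hc : 0 < c) (hc1 : c ≤ 1) :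
    Real.exp (-(Real.pi ^ 2 / c)) ≤ 1 / 8 := by
  have hpi := Real.pi_gt_three
  have h9 : 9 ≤ Real.pi ^ 2 / c := by
    rw [le_div_iff₀ hc]; nlinarith
  have h2 : (8 : ℝ) ≤ Real.exp (Real.pi ^ 2 / c) := by
    have := Real.add_one_le_exp (Real.pi ^ 2 / c); linarith
  rw [Real.exp_neg, inv_le_comm₀ (Real.exp_pos _) (by norm_num)]
  simpa using h2

lemma norm_exp_main_le (hc : 0 < c) (hc1 : c ≤ 1) (hre : t.re = c) :
    ‖Complex.exp (Real.pi ^ 2 / (12 * t) + t / 24)‖ ≤ 3 * Real.exp (Real.pi ^ 2 / (12 * c)) := by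
  have ht0 : t ≠ 0 := by rintro rfl; simp at hre; linarith
  have hn : 0 < Complex.normSq t := Complex.normSq_pos.2 ht0
  have e1 : (Real.pi ^ 2 / (12 * t) : ℂ) = ((Real.pi ^ 2 / 12 : ℝ) : ℂ) / t := by
    push_cast; rw [div_div]
  have e2 : (t / 24).re = c / 24 := by
    rw [show t / 24 = ((1 / 24 : ℝ) : ℂ) * t by push_cast; ring, Complex.re_ofReal_mul, hre]; ring
  rw [Complex.norm_exp, Complex.add_re, e2, e1, re_real_div, hre, Real.exp_add, mul_comm]
  have h3 : Real.exp (c / 24) ≤ 3 := by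
    have h := Real.exp_le_exp.2 (show c / 24 ≤ 1 by linarith)
    have := Real.exp_one_lt_d9
    linarith
  have h4 : c / Complex.normSq t ≤ 1 / c := by
    rw [div_le_div_iff₀ hn hc, Complex.normSq_apply, hre]; nlinarith [mul_self_nonneg t.im]
  have h5 : Real.pi ^ 2 / 12 * (c / Complex.normSq t) ≤ Real.pi ^ 2 / (12 * c) := by
    calc Real.pi ^ 2 / 12 * (c / Complex.normSq t) ≤ Real.pi ^ 2 / 12 * (1 / c) := by gcongr
      _ = _ := by field_simp
  gcongr

lemma norm_log_factor_le (hc : 0 < c) (hc1 : c ≤ 1) (hre : t.re = c) (him : |t.im| ≤ c) :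
    ‖((Real.log (Real.pi / 2) - Complex.log t) / 2 + t / 8 : ℂ)‖ ≤ 5 / c := by
  obtain ⟨h1, h2, _⟩ := norm_bounds_of_cone hc hre him
  have hpi3 := Real.pi_gt_three
  have hpi4 := Real.pi_lt_d2
  have hlogpi : |Real.log (Real.pi / 2)| ≤ 1 := by
    rw [abs_of_nonneg (Real.log_nonneg (by linarith))]
    have := Real.log_le_sub_one_of_pos (show 0 < Real.pi / 2 by positivity)
    linarith
  have hnpos : 0 < ‖t‖ := hc.trans_le h1
  have hcinv : 1 ≤ 1 / c := by rw [le_div_iff₀ hc]; linarith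
  have hlogn : |Real.log ‖t‖| ≤ 1 / c := by
    rw [abs_le]
    constructor
    · have h := Real.log_le_sub_one_of_pos (inv_pos.2 hnpos)
      rw [Real.log_inv] at h
      have : ‖t‖⁻¹ ≤ c⁻¹ := inv_anti₀ hc h1
      rw [one_div]; linarith
    · have h := Real.log_le_sub_one_of_pos hnpos
      linarith
  have hlog : ‖Complex.log t‖ ≤ 1 / c + 3.15 := by
    rw [Complex.log]
    refine (norm_add_le _ _).trans ?_
    rw [Complex.norm_real, Real.norm_eq_abs, norm_mul, Complex.norm_I, mul_one, Complex.norm_real,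
      Real.norm_eq_abs]
    have := Complex.abs_arg_le_pi t
    linarith
  have hl : ‖(Real.log (Real.pi / 2) : ℂ)‖ ≤ 1 := by
    rw [Complex.norm_real]; exact hlogpi
  calc ‖((Real.log (Real.pi / 2) - Complex.log t) / 2 + t / 8 : ℂ)‖
      ≤ ‖((Real.log (Real.pi / 2) - Complex.log t) / 2 : ℂ)‖ + ‖t / 8‖ := norm_add_le _ _
    _ ≤ (1 + (1 / c + 3.15)) / 2 + 2 / 8 := by
        rw [norm_div, norm_div]
        have h3 := norm_sub_le (Real.log (Real.pi / 2) : ℂ) (Complex.log t)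
        norm_num
        norm_num at hlog
        linarith
    _ ≤ 5 / c := by
        have : 5 / c = 5 * (1 / c) := by ring
        rw [this]; linarith

lemma norm_exp_dual_le (hc : 0 < c) (hc1 : c ≤ 1) (hre : t.re = c) (him : |t.im| ≤ c) :
    ‖Complex.exp (logEuler (4 * Real.pi ^ 2 / t) - logEuler (2 * Real.pi ^ 2 / t)) - 1‖ ≤
      16 * Real.exp (-(Real.pi ^ 2 / c)) := by
  obtain ⟨h1, h2⟩ := norm_dual_le hc hc1 hre him
  have h3 := exp_neg_pi_sq_div_le hc hc1
  have h4 := norm_sub_le (logEuler (4 * Real.pi ^ 2 / t)) (logEuler (2 * Real.pi ^ 2 / t))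
  have h5 := Complex.norm_exp_sub_one_le
    (x := logEuler (4 * Real.pi ^ 2 / t) - logEuler (2 * Real.pi ^ 2 / t)) (by linarith)
  linarith

lemma exp_logEuler_sub (ht : 0 < t.re) :
    Complex.exp (logEuler t - logEuler (2 * t)) =
      Complex.exp (Real.pi ^ 2 / (12 * t) + t / 24) / Real.sqrt 2 *
        Complex.exp (logEuler (4 * Real.pi ^ 2 / t) - logEuler (2 * Real.pi ^ 2 / t)) := by
  rw [logEuler_sub_logEuler_two_mul ht, Complex.exp_add, sub_eq_add_neg _ (Real.log 2 / 2 : ℂ),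
    Complex.exp_add, exp_neg_half_log_two]
  ring

lemma norm_div_sqrt_two_le (z : ℂ) : ‖z / (Real.sqrt 2 : ℂ)‖ ≤ ‖z‖ := by
  rw [norm_div, Complex.norm_real, Real.norm_of_nonneg (Real.sqrt_nonneg _)]
  exact div_le_self (norm_nonneg _) (Real.one_le_sqrt.2 (by norm_num))

lemma norm_exp_logEuler_sub_real_le (hc : 0 < c) (hc1 : c ≤ 1) :
    ‖Complex.exp (logEuler c - logEuler (2 * c))‖ ≤ 9 * Real.exp (Real.pi ^ 2 / (12 * c)) := by
  have hre : (c : ℂ).re = c := Complex.ofReal_re c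
  have him : |(c : ℂ).im| ≤ c := by simpa using hc.le
  rw [exp_logEuler_sub (by rwa [hre]), norm_mul]
  have h1 := (norm_div_sqrt_two_le _).trans (norm_exp_main_le hc hc1 hre)
  have h2 := norm_exp_dual_le hc hc1 hre him
  have h3 := exp_neg_pi_sq_div_le hc hc1
  set z := Complex.exp (logEuler (4 * Real.pi ^ 2 / (c : ℂ)) - logEuler (2 * Real.pi ^ 2 / (c : ℂ)))
  have h4 : ‖z‖ ≤ 3 := by
    have := norm_add_le (z - 1) 1
    rw [sub_add_cancel, norm_one] at this
    linarith
  calc _ ≤ 3 * Real.exp (Real.pi ^ 2 / (12 * c)) * 3 := by gcongr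
    _ = _ := by ring

/-- In the cone the dual terms have size at most a constant times `exp (-π ^ 2 / c)`. -/
theorem norm_recipGen_sub_main_le (hc : 0 < c) (hc1 : c ≤ 1) (hre : t.re = c) (him : |t.im| ≤ c) :
    ‖recipGen t - recipGenMain t‖ ≤
      700 / c * Real.exp (Real.pi ^ 2 / (12 * c) - Real.pi ^ 2 / c) := by
  have ht : 0 < t.re := by rwa [hre]
  rw [recipGen, recipGenMain, exp_logEuler_sub ht, logEuler_sub_two_mul_logEuler_two_mul ht]
  have h1 := (norm_div_sqrt_two_le _).trans (norm_exp_main_le hc hc1 hre)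
  have h2 := norm_exp_dual_le hc hc1 hre him
  have h3 := exp_neg_pi_sq_div_le hc hc1
  have h4 := norm_log_factor_le hc hc1 hre him
  obtain ⟨h5, h6⟩ := norm_dual_le hc hc1 hre him
  have h7 : ‖logEuler (4 * Real.pi ^ 2 / t) - 2 * logEuler (2 * Real.pi ^ 2 / t)‖ ≤
      12 * Real.exp (-(Real.pi ^ 2 / c)) := by
    refine (norm_sub_le _ _).trans ?_
    rw [norm_mul]
    norm_num
    linarith
  set a := Complex.exp (Real.pi ^ 2 / (12 * t) + t / 24) / (Real.sqrt 2 : ℂ)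
  set z := Complex.exp (logEuler (4 * Real.pi ^ 2 / t) - logEuler (2 * Real.pi ^ 2 / t))
  set d := logEuler (4 * Real.pi ^ 2 / t) - 2 * logEuler (2 * Real.pi ^ 2 / t)
  set b := ((Real.log (Real.pi / 2) - Complex.log t) / 2 + t / 8 : ℂ)
  set e := Real.exp (-(Real.pi ^ 2 / c)) with he
  have hepos : 0 < e := Real.exp_pos _
  have hz : ‖z‖ ≤ 3 := by
    have := norm_add_le (z - 1) 1
    rw [sub_add_cancel, norm_one] at this
    linarith
  have hcinv : 1 ≤ 1 / c := by rw [le_div_iff₀ hc]; linarith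
  have hid : a * z * (b + d) - a * b = a * ((z - 1) * b + z * d) := by ring
  rw [hid, norm_mul, sub_eq_add_neg (Real.pi ^ 2 / (12 * c)), Real.exp_add, ← he]
  have hin : ‖(z - 1) * b + z * d‖ ≤ 16 * e * (5 / c) + 3 * (12 * e) := by
    refine (norm_add_le _ _).trans ?_
    rw [norm_mul, norm_mul]
    gcongr
  have hin2 : 16 * e * (5 / c) + 3 * (12 * e) ≤ 116 * (1 / c) * e := by
    have e1 : 16 * e * (5 / c) = 80 * (1 / c) * e := by ring
    have e2 : 36 * e * 1 ≤ 36 * e * (1 / c) := by gcongr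
    linarith
  calc ‖a‖ * ‖(z - 1) * b + z * d‖
      ≤ 3 * Real.exp (Real.pi ^ 2 / (12 * c)) * (116 * (1 / c) * e) := by
        gcongr
        exact hin.trans hin2
    _ = 348 / c * (Real.exp (Real.pi ^ 2 / (12 * c)) * e) := by ring
    _ ≤ _ := by gcongr; norm_num

end Cone

/-- The saving on the minor arcs: with `r = exp (-c)` and `q = r exp (-i θ)` the gap is
`(1 + r) / (2 (1 - r)) * x / ((1 - r) ^ 2 + x)` with `x = 2 r (1 - cos θ)`, which is about
`1 / (2 c)` at `θ = c` and increases with `|θ|`. -/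
lemma re_one_div_one_sub_exp_gap {c θ : ℝ} (hc : 0 < c) (hc1 : c ≤ 1 / 20) (hθ : c ≤ |θ|)
    (hθ' : |θ| ≤ Real.pi) :
    2 / 5 / c ≤ 1 / (1 - Real.exp (-c)) -
      (1 / (1 - Complex.exp (-(c + θ * Complex.I)))).re := by
  set r := Real.exp (-c) with hr
  have hr0 : 0 < r := Real.exp_pos _
  have hr1 : r < 1 := by rw [hr, Real.exp_lt_one_iff]; linarith
  have hrc : 1 - c ≤ r := by have := Real.add_one_le_exp (-c); linarith
  have hqre : (Complex.exp (-(c + θ * Complex.I))).re = r * Real.cos θ := by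
    rw [Complex.exp_re]; simp [hr]
  have hqim : (Complex.exp (-(c + θ * Complex.I))).im = -(r * Real.sin θ) := by
    rw [Complex.exp_im]; simp [hr]
  have hns : Complex.normSq (1 - Complex.exp (-(c + θ * Complex.I))) =
      (1 - r) ^ 2 + 2 * r * (1 - Real.cos θ) := by
    rw [Complex.normSq_apply, Complex.sub_re, Complex.sub_im, hqre, hqim, Complex.one_re,
      Complex.one_im]
    linear_combination r ^ 2 * Real.sin_sq_add_cos_sq θ
  have hcos : Real.cos θ ≤ Real.cos c := by
    rw [← Real.cos_abs θ]
    exact Real.cos_le_cos_of_nonneg_of_le_pi hc.le hθ' hθ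
  have hcosc : Real.cos c ≤ 1 - c ^ 2 / 2 + c ^ 4 * (5 / 96) := by
    have h := Real.cos_bound (x := c) (by rw [abs_of_pos hc]; linarith)
    rw [abs_of_pos hc] at h
    have := (abs_le.1 h).2
    linarith
  set w := 1 - Real.cos θ with hw
  have hwge : 0.499 * c ^ 2 ≤ w := by
    have hcc : c ^ 2 ≤ 1 / 400 := by nlinarith
    have : c ^ 4 * (5 / 96) ≤ 0.001 * c ^ 2 := by
      have e : c ^ 4 = c ^ 2 * c ^ 2 := by ring
      rw [e]; nlinarith [sq_nonneg c]
    linarith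
  have hx : 0.9 * c ^ 2 ≤ 2 * r * w := by
    have hr95 : 0.95 ≤ r := by linarith
    nlinarith [sq_nonneg c]
  have ha : (1 - r) ^ 2 ≤ c ^ 2 := by nlinarith
  set x := 2 * r * w with hxdef
  have hcc : 0 < c ^ 2 := by positivity
  have hxpos : 0 < x := by nlinarith
  have hapos : 0 < (1 - r) ^ 2 := pow_pos (by linarith) 2
  have hD : 0 < (1 - r) ^ 2 + x := by positivity
  have hre1 : (1 / (1 - Complex.exp (-(c + θ * Complex.I)))).re =
      (1 - r * Real.cos θ) / ((1 - r) ^ 2 + x) := by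
    rw [one_div, Complex.inv_re, hns, Complex.sub_re, hqre, Complex.one_re]
  have hdiff : 1 / (1 - r) - (1 - r * Real.cos θ) / ((1 - r) ^ 2 + x) =
      (1 + r) / 2 * (1 / (1 - r)) * (x / ((1 - r) ^ 2 + x)) := by
    have h1r : 1 - r ≠ 0 := by linarith
    have hDne := hD.ne'
    have hcosw : Real.cos θ = 1 - w := by rw [hw]; ring
    rw [hcosw]
    field_simp
    rw [hxdef]
    ring
  rw [hre1, hdiff]
  have h1 : 0.97 ≤ (1 + r) / 2 := by linarith
  have h2 : 1 / c ≤ 1 / (1 - r) := one_div_le_one_div_of_le (by linarith) (by linarith)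
  have h3 : 0.45 ≤ x / ((1 - r) ^ 2 + x) := by
    rw [le_div_iff₀ hD]; nlinarith
  calc 2 / 5 / c = 2 / 5 * (1 / c) := by ring
    _ ≤ 0.97 * (1 / c) * 0.45 := by
        have : 0 < 1 / c := by positivity
        nlinarith
    _ ≤ _ := by gcongr

/-- The bound for the generating function away from the major arc. The exponent is to be compared
with the value `π ^ 2 / (12 c)` at the positive real point of the same circle. -/
theorem norm_recipGen_le_of_minor_arc {c θ : ℝ} (hc : 0 < c) (hc1 : c ≤ 1 / 20) (hθ : c ≤ |θ|)
    (hθ' : |θ| ≤ Real.pi) :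
    ‖recipGen (c + θ * Complex.I)‖ ≤
      36 / c ^ 2 * Real.exp (Real.pi ^ 2 / (12 * c) - 1 / (10 * c)) := by
  have hre : (c + θ * Complex.I : ℂ).re = c := by simp
  have ht : 0 < (c + θ * Complex.I : ℂ).re := by rwa [hre]
  have h1 := norm_exp_logEuler_sub_le ht
  have h2 := norm_logEuler_sub_two_mul_le ht
  rw [hre] at h1 h2
  have h3 := norm_exp_logEuler_sub_real_le hc (by linarith)
  have h4 := re_one_div_one_sub_exp_gap hc hc1 hθ hθ'
  have hr : (1 - Real.exp (-c))⁻¹ ≤ 2 / c := by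
    have h5 : Real.exp (-c) ≤ 1 - c / 2 := by
      have h6 := Real.add_one_le_exp c
      rw [Real.exp_neg, inv_le_comm₀ (Real.exp_pos _) (by linarith)]
      refine le_trans ?_ h6
      rw [inv_le_iff_one_le_mul₀ (by linarith)]
      nlinarith
    rw [show 2 / c = (c / 2)⁻¹ by rw [inv_div]]
    exact inv_anti₀ (by positivity) (by linarith)
  have hr0 : 0 ≤ (1 - Real.exp (-c))⁻¹ := by
    rw [inv_nonneg, sub_nonneg, Real.exp_le_one_iff]; linarith
  rw [recipGen, norm_mul, sub_eq_add_neg (Real.pi ^ 2 / (12 * c)), Real.exp_add]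
  have h7 : Real.exp (-((1 / (1 - Real.exp (-c)) -
      (1 / (1 - Complex.exp (-(c + θ * Complex.I)))).re) / 4)) ≤ Real.exp (-(1 / (10 * c))) := by
    rw [Real.exp_le_exp]
    have : 1 / (10 * c) = 2 / 5 / c / 4 := by field_simp; norm_num
    rw [this]
    linarith
  calc _ ≤ (9 * Real.exp (Real.pi ^ 2 / (12 * c)) * Real.exp (-(1 / (10 * c)))) * (2 / c) ^ 2 := by
        refine mul_le_mul (h1.trans ?_) (h2.trans ?_) (norm_nonneg _) (by positivity)
        · gcongr
        · gcongr
    _ = _ := by ring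

/-! ### The saddle point -/

lemma differentiableAt_logEuler {t : ℂ} (ht : 0 < t.re) : DifferentiableAt ℂ logEuler t :=
  (hasDerivAt_logEuler_tsum ht).differentiableAt

lemma differentiableAt_recipGen {t : ℂ} (ht : 0 < t.re) : DifferentiableAt ℂ recipGen t := by
  have h1 := differentiableAt_logEuler ht
  have h2 : DifferentiableAt ℂ (fun t => logEuler (2 * t)) t :=
    (differentiableAt_logEuler (re_two_mul_pos ht)).comp t (by fun_prop)
  unfold recipGen
  exact (h1.sub h2).cexp.mul (h1.sub (h2.const_mul 2))

lemma differentiableAt_recipGenMain {t : ℂ} (ht : 0 < t.re) :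
    DifferentiableAt ℂ recipGenMain t := by
  have ht0 : 12 * t ≠ 0 := by
    rw [mul_ne_zero_iff]
    exact ⟨by norm_num, by rintro rfl; simp at ht⟩
  have hlog : DifferentiableAt ℂ Complex.log t := Complex.differentiableAt_log (Or.inl ht)
  unfold recipGenMain
  fun_prop (disch := assumption)

/-- Deformation of a vertical segment into the circular arc about the origin with the same
end points. -/
lemma integral_segment_eq_integral_arc {f : ℂ → ℂ} (hf : ∀ t : ℂ, 0 < t.re → DifferentiableAt ℂ f t)
    {c : ℝ} (hc : 0 < c) :
    ∫ θ in (-c)..c, f (c + θ * Complex.I) =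
      ∫ φ in (-(Real.pi / 4))..(Real.pi / 4),
        f ((Real.sqrt 2 * c : ℝ) * Complex.exp (φ * Complex.I)) *
          ((Real.sqrt 2 * c : ℝ) * Complex.exp (φ * Complex.I)) := by
  -- Both paths lie in a disc contained in the right half plane, where `f` has a primitive.
  have hball : ∀ z : ℂ, Complex.normSq z < 4 * c * z.re → z ∈ Metric.ball (2 * c : ℂ) (2 * c) := by
    intro z hz
    rw [Metric.mem_ball, dist_eq_norm]
    refine lt_of_pow_lt_pow_left₀ 2 (by positivity) ?_
    rw [← Complex.normSq_eq_norm_sq, Complex.normSq_apply]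
    rw [Complex.normSq_apply] at hz
    simp
    nlinarith
  have hre : ∀ z ∈ Metric.ball (2 * c : ℂ) (2 * c), 0 < z.re := by
    intro z hz
    rw [Metric.mem_ball, dist_eq_norm] at hz
    have h1 := (Complex.abs_re_le_norm (z - 2 * c)).trans_lt hz
    have h2 := (abs_lt.1 h1).1
    simp at h2
    linarith
  have hdiff : DifferentiableOn ℂ f (Metric.ball (2 * c : ℂ) (2 * c)) :=
    fun z hz => (hf z (hre z hz)).differentiableWithinAt
  obtain ⟨H, hH⟩ := hdiff.isExactOn_ball
  have hcont : ContinuousOn f (Metric.ball (2 * c : ℂ) (2 * c)) := hdiff.continuousOn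
  have hseg : ∀ θ ∈ Set.uIcc (-c) c, (c + θ * Complex.I : ℂ) ∈ Metric.ball (2 * c : ℂ) (2 * c) := by
    intro θ hθ
    rw [Set.uIcc_of_le (by linarith)] at hθ
    refine hball _ ?_
    rw [Complex.normSq_apply]
    simp
    nlinarith [hθ.1, hθ.2]
  have harc : ∀ φ ∈ Set.uIcc (-(Real.pi / 4)) (Real.pi / 4),
      ((Real.sqrt 2 * c : ℝ) * Complex.exp (φ * Complex.I) : ℂ) ∈
        Metric.ball (2 * c : ℂ) (2 * c) := by
    intro φ hφ
    have hpi := Real.pi_pos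
    rw [Set.uIcc_of_le (by linarith)] at hφ
    refine hball _ ?_
    have hcos : Real.sqrt 2 / 2 ≤ Real.cos φ := by
      rw [← Real.cos_pi_div_four, ← Real.cos_abs φ]
      exact Real.cos_le_cos_of_nonneg_of_le_pi (abs_nonneg _) (by linarith) (abs_le.2 hφ)
    have hs2 : Real.sqrt 2 * Real.sqrt 2 = 2 := Real.mul_self_sqrt (by norm_num)
    have hs0 : 0 < Real.sqrt 2 := by positivity
    rw [Complex.normSq_mul, Complex.normSq_ofReal, Complex.normSq_eq_norm_sq,
      Complex.norm_exp_ofReal_mul_I, Complex.re_ofReal_mul, Complex.exp_ofReal_mul_I_re]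
    have e1 : Real.sqrt 2 * c * (Real.sqrt 2 * c) * 1 ^ 2 = 2 * c ^ 2 := by
      linear_combination c ^ 2 * hs2
    have e2 : 4 * c * (Real.sqrt 2 * c * (Real.sqrt 2 / 2)) = 4 * c ^ 2 := by
      linear_combination 2 * c ^ 2 * hs2
    rw [e1]
    have : 4 * c * (Real.sqrt 2 * c * (Real.sqrt 2 / 2)) ≤
        4 * c * (Real.sqrt 2 * c * Real.cos φ) := by gcongr
    nlinarith [sq_nonneg c, mul_pos hc hc]
  have hderiv1 : ∀ θ ∈ Set.uIcc (-c) c, HasDerivAt (fun θ : ℝ => H (c + θ * Complex.I))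
      (f (c + θ * Complex.I) * Complex.I) θ := by
    intro θ hθ
    have h1 : HasDerivAt (fun θ : ℝ => (c + θ * Complex.I : ℂ)) (1 * Complex.I) θ :=
      ((Complex.ofRealCLM.hasDerivAt (x := θ)).mul_const Complex.I).const_add (c : ℂ)
    rw [one_mul] at h1
    exact (hH _ (hseg θ hθ)).comp θ h1
  have hderiv2 : ∀ φ ∈ Set.uIcc (-(Real.pi / 4)) (Real.pi / 4),
      HasDerivAt (fun φ : ℝ => H ((Real.sqrt 2 * c : ℝ) * Complex.exp (φ * Complex.I)))
      (f ((Real.sqrt 2 * c : ℝ) * Complex.exp (φ * Complex.I)) *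
          ((Real.sqrt 2 * c : ℝ) * Complex.exp (φ * Complex.I)) * Complex.I) φ := by
    intro φ hφ
    have h1 : HasDerivAt (fun φ : ℝ => (φ * Complex.I : ℂ)) (1 * Complex.I) φ :=
      (Complex.ofRealCLM.hasDerivAt (x := φ)).mul_const Complex.I
    have h2 := (h1.cexp).const_mul ((Real.sqrt 2 * c : ℝ) : ℂ)
    refine ((hH _ (harc φ hφ)).comp φ h2).congr_deriv ?_
    ring
  have hc1 : ContinuousOn (fun θ : ℝ => f (c + θ * Complex.I)) (Set.uIcc (-c) c) :=
    hcont.comp (Continuous.continuousOn (by fun_prop)) hseg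
  have hc2 : ContinuousOn (fun φ : ℝ => f ((Real.sqrt 2 * c : ℝ) * Complex.exp (φ * Complex.I)))
      (Set.uIcc (-(Real.pi / 4)) (Real.pi / 4)) :=
    hcont.comp (Continuous.continuousOn (by fun_prop)) harc
  have hI1 := intervalIntegral.integral_eq_sub_of_hasDerivAt hderiv1
    (hc1.mul continuousOn_const).intervalIntegrable
  have hI2 := intervalIntegral.integral_eq_sub_of_hasDerivAt hderiv2
    ((hc2.mul (Continuous.continuousOn (by fun_prop))).mul continuousOn_const).intervalIntegrable
  have hend : ∀ σ : ℝ, σ ^ 2 = 1 → ((Real.sqrt 2 * c : ℝ) : ℂ) *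
      Complex.exp (((σ * (Real.pi / 4) : ℝ) : ℂ) * Complex.I) = c + (σ * c : ℝ) * Complex.I := by
    intro σ hσ
    have hs2 : Real.sqrt 2 * Real.sqrt 2 = 2 := Real.mul_self_sqrt (by norm_num)
    have hσ' : σ = 1 ∨ σ = -1 := mul_self_eq_one_iff.1 (by rw [← sq]; exact hσ)
    rcases hσ' with rfl | rfl
    · apply Complex.ext
      · rw [Complex.re_ofReal_mul, Complex.exp_ofReal_mul_I_re]
        simp
        linear_combination c / 2 * hs2
      · rw [Complex.im_ofReal_mul, Complex.exp_ofReal_mul_I_im]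
        simp
        linear_combination c / 2 * hs2
    · apply Complex.ext
      · rw [Complex.re_ofReal_mul, Complex.exp_ofReal_mul_I_re]
        simp
        linear_combination c / 2 * hs2
      · rw [Complex.im_ofReal_mul, Complex.exp_ofReal_mul_I_im]
        simp
        linear_combination (c / 2) * hs2
  have hp := hend 1 (by norm_num)
  have hm := hend (-1) (by norm_num)
  rw [one_mul, one_mul] at hp
  rw [neg_one_mul, neg_one_mul] at hm
  rw [hp, hm, ← hI1, intervalIntegral.integral_mul_const, intervalIntegral.integral_mul_const] at hI2
  exact (mul_right_cancel₀ Complex.I_ne_zero hI2).symm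

/-- The coefficient integral reduced to the segment `|θ| ≤ c` of the vertical line and to the
approximation `recipGenMain`. -/
lemma norm_s1_sub_segment_le (n : ℕ) {c : ℝ} (hc : 0 < c) (hc1 : c ≤ 1 / 20) :
    ‖(s1 n : ℂ) - 1 / (2 * Real.pi) * ∫ θ in (-c)..c,
      recipGenMain (c + θ * Complex.I) * Complex.exp (n * (c + θ * Complex.I))‖ ≤
      300 / c ^ 2 * Real.exp (Real.pi ^ 2 / (12 * c) + n * c - 1 / (10 * c)) := by
  have hpi := Real.pi_gt_three
  have hpi4 := Real.pi_lt_d2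
  have hre : ∀ θ : ℝ, 0 < (c + θ * Complex.I : ℂ).re := by intro θ; simpa using hc
  have hexpn : ∀ θ : ℝ, ‖Complex.exp (n * (c + θ * Complex.I))‖ = Real.exp (n * c) := by
    intro θ; rw [Complex.norm_exp]; simp
  let g : ℝ → ℂ := fun θ => recipGen (c + θ * Complex.I) * Complex.exp (n * (c + θ * Complex.I))
  let m : ℝ → ℂ := fun θ =>
    recipGenMain (c + θ * Complex.I) * Complex.exp (n * (c + θ * Complex.I))
  have hg : Continuous g := by
    refine continuous_iff_continuousAt.2 fun θ => ContinuousAt.mul ?_ (by fun_prop)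
    exact (differentiableAt_recipGen (hre θ)).continuousAt.comp
      (f := fun θ : ℝ => (c + θ * Complex.I : ℂ)) (by fun_prop)
  have hm : Continuous m := by
    refine continuous_iff_continuousAt.2 fun θ => ContinuousAt.mul ?_ (by fun_prop)
    exact (differentiableAt_recipGenMain (hre θ)).continuousAt.comp
      (f := fun θ : ℝ => (c + θ * Complex.I : ℂ)) (by fun_prop)
  set E := Real.exp (Real.pi ^ 2 / (12 * c) + n * c - 1 / (10 * c)) with hE
  have hE0 : 0 < E := Real.exp_pos _
  have hminor : ∀ θ : ℝ, c ≤ |θ| → |θ| ≤ Real.pi → ‖g θ‖ ≤ 36 / c ^ 2 * E := by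
    intro θ h1 h2
    have h := norm_recipGen_le_of_minor_arc hc hc1 h1 h2
    simp only [g]
    rw [norm_mul, hexpn]
    calc _ ≤ 36 / c ^ 2 * Real.exp (Real.pi ^ 2 / (12 * c) - 1 / (10 * c)) * Real.exp (n * c) := by
          gcongr
      _ = 36 / c ^ 2 * E := by
          rw [mul_assoc, ← Real.exp_add, hE]; congr 2; ring
  have hmajor : ∀ θ : ℝ, |θ| ≤ c → ‖g θ - m θ‖ ≤ 700 / c * E := by
    intro θ h1
    have h := norm_recipGen_sub_main_le (t := c + θ * Complex.I) hc (by linarith) (by simp)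
      (by simpa using h1)
    simp only [g, m]
    rw [← sub_mul, norm_mul, hexpn]
    calc _ ≤ 700 / c * Real.exp (Real.pi ^ 2 / (12 * c) - Real.pi ^ 2 / c) * Real.exp (n * c) := by
          gcongr
      _ = 700 / c * Real.exp (Real.pi ^ 2 / (12 * c) + n * c - Real.pi ^ 2 / c) := by
          rw [mul_assoc, ← Real.exp_add]; congr 2; ring
      _ ≤ 700 / c * E := by
          have : 1 / (10 * c) ≤ Real.pi ^ 2 / c := by
            have h9 : 9 ≤ Real.pi ^ 2 := by nlinarith
            rw [div_le_div_iff₀ (by positivity) hc]; nlinarith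
          rw [hE]
          gcongr
  have hi : ∀ a b : ℝ, IntervalIntegrable g MeasureTheory.volume a b :=
    fun a b => hg.intervalIntegrable a b
  have hsplit : ∫ θ in (-Real.pi)..Real.pi, g θ = (∫ θ in (-Real.pi)..(-c), g θ) +
      (∫ θ in (-c)..c, g θ) + ∫ θ in c..Real.pi, g θ := by
    rw [intervalIntegral.integral_add_adjacent_intervals (hi _ _) (hi _ _),
      intervalIntegral.integral_add_adjacent_intervals (hi _ _) (hi _ _)]
  have b1 : ‖∫ θ in (-Real.pi)..(-c), g θ‖ ≤ 36 / c ^ 2 * E * Real.pi := by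
    refine (intervalIntegral.norm_integral_le_of_norm_le_const (C := 36 / c ^ 2 * E)
      fun θ hθ => ?_).trans ?_
    · rw [Set.uIoc_of_le (by linarith)] at hθ
      have : |θ| = -θ := abs_of_nonpos (by linarith [hθ.2])
      exact hminor θ (by rw [this]; linarith [hθ.2]) (by rw [this]; linarith [hθ.1])
    · rw [abs_of_nonneg (by linarith)]
      gcongr
      linarith
  have b3 : ‖∫ θ in c..Real.pi, g θ‖ ≤ 36 / c ^ 2 * E * Real.pi := by
    refine (intervalIntegral.norm_integral_le_of_norm_le_const (C := 36 / c ^ 2 * E)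
      fun θ hθ => ?_).trans ?_
    · rw [Set.uIoc_of_le (by linarith)] at hθ
      have : |θ| = θ := abs_of_nonneg (by linarith [hθ.1])
      exact hminor θ (by rw [this]; linarith [hθ.1]) (by rw [this]; linarith [hθ.2])
    · rw [abs_of_nonneg (by linarith)]
      gcongr
      linarith
  have b2 : ‖(∫ θ in (-c)..c, g θ) - ∫ θ in (-c)..c, m θ‖ ≤ 1400 * E := by
    rw [← intervalIntegral.integral_sub (hi _ _) (hm.intervalIntegrable _ _)]
    refine (intervalIntegral.norm_integral_le_of_norm_le_const (C := 700 / c * E)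
      fun θ hθ => ?_).trans ?_
    · rw [Set.uIoc_of_le (by linarith)] at hθ
      exact hmajor θ (abs_le.2 ⟨hθ.1.le, hθ.2⟩)
    · rw [abs_of_nonneg (by linarith)]
      apply le_of_eq
      field_simp
      ring
  have hs := s1_eq_integral n hc
  change (s1 n : ℂ) = 1 / (2 * Real.pi) * ∫ θ in (-Real.pi)..Real.pi, g θ at hs
  change ‖(s1 n : ℂ) - 1 / (2 * Real.pi) * ∫ θ in (-c)..c, m θ‖ ≤ _
  rw [hs, hsplit, ← mul_sub, norm_mul]
  have hnpi : ‖(1 / (2 * Real.pi) : ℂ)‖ = 1 / (2 * Real.pi) := by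
    rw [show (1 / (2 * Real.pi) : ℂ) = ((1 / (2 * Real.pi) : ℝ) : ℂ) by push_cast; ring,
      Complex.norm_real, Real.norm_of_nonneg (by positivity)]
  rw [hnpi]
  have htot : ‖(∫ θ in (-Real.pi)..(-c), g θ) + (∫ θ in (-c)..c, g θ) +
      (∫ θ in c..Real.pi, g θ) - ∫ θ in (-c)..c, m θ‖ ≤
      36 / c ^ 2 * E * Real.pi + 1400 * E + 36 / c ^ 2 * E * Real.pi := by
    have e : (∫ θ in (-Real.pi)..(-c), g θ) + (∫ θ in (-c)..c, g θ) +
      (∫ θ in c..Real.pi, g θ) - ∫ θ in (-c)..c, m θ = (∫ θ in (-Real.pi)..(-c), g θ) +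
        ((∫ θ in (-c)..c, g θ) - ∫ θ in (-c)..c, m θ) + ∫ θ in c..Real.pi, g θ := by ring
    rw [e]
    exact norm_add₃_le.trans (by linarith)
  have hcc : 1 ≤ 1 / c ^ 2 := by
    rw [le_div_iff₀ (by positivity)]; nlinarith
  calc 1 / (2 * Real.pi) * _ ≤ 1 / (2 * Real.pi) *
        (36 / c ^ 2 * E * Real.pi + 1400 * E + 36 / c ^ 2 * E * Real.pi) := by gcongr
    _ = 36 * (1 / c ^ 2) * E + 700 * E / Real.pi := by field_simp; ring
    _ ≤ 36 * (1 / c ^ 2) * E + 700 * E / 3 := by gcongr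
    _ ≤ 300 * (1 / c ^ 2) * E := by
        have : E * 1 ≤ E * (1 / c ^ 2) := by gcongr
        linarith
    _ = _ := by ring

/-- The contribution of the saddle point. On the arc `t = t₀ exp (i φ)` with
`t₀ = π ^ 2 / (12 X)` the exponent is the real number `2 X cos φ`. -/
noncomputable def saddleIntegral (X t₀ : ℝ) : ℝ :=
  ∫ φ in (-(Real.pi / 4))..(Real.pi / 4), Real.exp (2 * X * Real.cos φ) *
    (Real.log (Real.pi / (2 * t₀)) / 2 * Real.cos φ + φ / 2 * Real.sin φ +
      t₀ / 8 * Real.cos (2 * φ))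

lemma recipGenMain_arc_re (n : ℕ) {t₀ X φ : ℝ} (ht : 0 < t₀) (hX : (n + 1 / 24) * t₀ = X)
    (hX' : Real.pi ^ 2 / (12 * t₀) = X) (hφ : |φ| ≤ Real.pi / 4) :
    (recipGenMain (t₀ * Complex.exp (φ * Complex.I)) *
      Complex.exp (n * (t₀ * Complex.exp (φ * Complex.I))) *
        (t₀ * Complex.exp (φ * Complex.I))).re =
      t₀ / Real.sqrt 2 * (Real.exp (2 * X * Real.cos φ) *
    (Real.log (Real.pi / (2 * t₀)) / 2 * Real.cos φ + φ / 2 * Real.sin φ +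
      t₀ / 8 * Real.cos (2 * φ))) := by
  have hpi := Real.pi_pos
  obtain ⟨hφ1, hφ2⟩ := abs_le.1 hφ
  have ht0 : (t₀ : ℂ) ≠ 0 := by exact_mod_cast ht.ne'
  have he0 : Complex.exp (φ * Complex.I) ≠ 0 := Complex.exp_ne_zero _
  have hlog : Complex.log (t₀ * Complex.exp (φ * Complex.I)) = Real.log t₀ + φ * Complex.I := by
    rw [Complex.log_ofReal_mul ht he0, Complex.log_exp]
    · simp; linarith
    · simp; linarith
  have hexp : Complex.exp (Real.pi ^ 2 / (12 * (t₀ * Complex.exp (φ * Complex.I))) +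
        t₀ * Complex.exp (φ * Complex.I) / 24) *
      Complex.exp (n * (t₀ * Complex.exp (φ * Complex.I))) =
      (Real.exp (2 * X * Real.cos φ) : ℂ) := by
    rw [← Complex.exp_add, Complex.ofReal_exp]
    congr 1
    have h1 : (Real.pi ^ 2 / (12 * (t₀ * Complex.exp (φ * Complex.I))) : ℂ) =
        X * Complex.exp (-(φ : ℂ) * Complex.I) := by
      rw [← hX', neg_mul, Complex.exp_neg]
      push_cast
      field_simp
    have h2 : (2 * Complex.cos (φ : ℂ)) =
        Complex.exp (φ * Complex.I) + Complex.exp (-(φ : ℂ) * Complex.I) := by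
      rw [Complex.two_cos]
    have h3 : ((n : ℂ) + 1 / 24) * t₀ = X := by rw [← hX]; push_cast; ring
    rw [h1]
    push_cast
    linear_combination Complex.exp (φ * Complex.I) * h3 - X * h2
  have hsplit : recipGenMain (t₀ * Complex.exp (φ * Complex.I)) *
      Complex.exp (n * (t₀ * Complex.exp (φ * Complex.I))) *
        (t₀ * Complex.exp (φ * Complex.I)) =
      ((t₀ / Real.sqrt 2 * Real.exp (2 * X * Real.cos φ) : ℝ) : ℂ) *
        (Complex.exp (φ * Complex.I) * ((Real.log (Real.pi / (2 * t₀)) / 2 : ℝ) -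
          (φ / 2 : ℝ) * Complex.I + (t₀ / 8 : ℝ) * Complex.exp (φ * Complex.I))) := by
    have hl : Real.log (Real.pi / (2 * t₀)) = Real.log (Real.pi / 2) - Real.log t₀ := by
      rw [← div_div, Real.log_div (by positivity) ht.ne']
    rw [recipGenMain, hlog, hl, Complex.ofReal_mul, ← hexp]
    push_cast
    ring
  have hdouble : Real.cos (2 * φ) = Real.cos φ * Real.cos φ - Real.sin φ * Real.sin φ := by
    rw [two_mul, Real.cos_add]
  rw [hsplit, Complex.re_ofReal_mul, hdouble]
  have hr : (Complex.exp (φ * Complex.I)).re = Real.cos φ := Complex.exp_ofReal_mul_I_re φ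
  have hi : (Complex.exp (φ * Complex.I)).im = Real.sin φ := Complex.exp_ofReal_mul_I_im φ
  simp only [Complex.mul_re, Complex.mul_im, Complex.add_re, Complex.sub_re, Complex.add_im,
    Complex.sub_im, hr, hi, Complex.ofReal_re, Complex.ofReal_im, Complex.I_re, Complex.I_im]
  ring

/-- Moving the vertical line from `t₀` to `t₀ / √2` raises the exponent from `2 X` to
`(√2 + 1 / √2) X`, about `2.122 X`; the minor arcs save `1 / (10 c)`, more than `0.171 X`, so the
error stays exponentially smaller than `exp (2 X)`. -/
lemma saddle_error_le (n : ℕ) {t₀ X : ℝ} (ht : 0 < t₀)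
    (hX : (n + 1 / 24) * t₀ = X) (hX' : Real.pi ^ 2 / (12 * t₀) = X) :
    300 / (t₀ / Real.sqrt 2) ^ 2 * Real.exp (Real.pi ^ 2 / (12 * (t₀ / Real.sqrt 2)) +
      n * (t₀ / Real.sqrt 2) - 1 / (10 * (t₀ / Real.sqrt 2))) ≤
      900 * X ^ 2 * Real.exp (1.96 * X) := by
  have hpi := Real.pi_pos
  have hs2 : Real.sqrt 2 * Real.sqrt 2 = 2 := Real.mul_self_sqrt (by norm_num)
  have hs0 : 0 < Real.sqrt 2 := by positivity
  have hs14 : 1.4142 < Real.sqrt 2 := Real.lt_sqrt_of_sq_lt (by norm_num)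
  have hs15 : Real.sqrt 2 < 1.4143 := (Real.sqrt_lt' (by norm_num)).2 (by norm_num)
  set c := t₀ / Real.sqrt 2 with hcdef
  have hc : 0 < c := by positivity
  have hct : Real.sqrt 2 * c = t₀ := by rw [hcdef]; field_simp
  have hXpos : 0 < X := by rw [← hX']; positivity
  have hpisq1 : Real.pi ^ 2 < 9.87 := by
    have h1 := Real.pi_lt_d4; nlinarith
  have hpisq2 : 9.85 < Real.pi ^ 2 := by
    have h1 := Real.pi_gt_d4; nlinarith
  have hcinv : 1 / c = Real.sqrt 2 * (12 * X / Real.pi ^ 2) := by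
    rw [hcdef, ← hX']; field_simp
  have hexp1 : Real.pi ^ 2 / (12 * c) = Real.sqrt 2 * X := by
    rw [← hX', hcdef]; field_simp
  have hexp2 : (n : ℝ) * c ≤ Real.sqrt 2 / 2 * X := by
    have : (n : ℝ) * t₀ ≤ X := by rw [← hX]; nlinarith
    have e : (n : ℝ) * c = Real.sqrt 2 / 2 * (n * t₀) := by
      rw [← hct]; linear_combination -(n * c / 2) * hs2
    rw [e]
    gcongr
  have hlow : 1.2158 * X ≤ 12 * X / Real.pi ^ 2 := by
    rw [le_div_iff₀ (by positivity)]; nlinarith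
  have hupp : 12 * X / Real.pi ^ 2 ≤ 1.2183 * X := by
    rw [div_le_iff₀ (by positivity)]; nlinarith
  have hexp3 : 0.1719 * X ≤ 1 / (10 * c) := by
    have e : 1 / (10 * c) = Real.sqrt 2 * (12 * X / Real.pi ^ 2) / 10 := by
      rw [← hcinv]; field_simp
    rw [e]
    have : 1.4142 * (1.2158 * X) ≤ Real.sqrt 2 * (12 * X / Real.pi ^ 2) := by gcongr
    linarith
  have hexp4 : Real.pi ^ 2 / (12 * c) + n * c - 1 / (10 * c) ≤ 1.96 * X := by
    rw [hexp1]
    have : Real.sqrt 2 * X ≤ 1.4143 * X := by gcongr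
    linarith
  have hpre : 300 / c ^ 2 ≤ 900 * X ^ 2 := by
    have e : 300 / c ^ 2 = 300 * (2 * (12 * X / Real.pi ^ 2) ^ 2) := by
      have : 300 / c ^ 2 = 300 * (1 / c) ^ 2 := by field_simp
      rw [this, hcinv, mul_pow, Real.sq_sqrt (by norm_num)]
    rw [e]
    have : (12 * X / Real.pi ^ 2) ^ 2 ≤ (1.2183 * X) ^ 2 := by gcongr
    rw [mul_pow] at this
    nlinarith [sq_nonneg X]
  gcongr

theorem abs_s1_sub_saddle_le (n : ℕ) {t₀ X : ℝ} (ht : 0 < t₀) (ht1 : t₀ ≤ 1 / 20)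
    (hX : (n + 1 / 24) * t₀ = X) (hX' : Real.pi ^ 2 / (12 * t₀) = X) :
    |s1 n - t₀ / (2 * Real.sqrt 2 * Real.pi) * saddleIntegral X t₀| ≤
      900 * X ^ 2 * Real.exp (1.96 * X) := by
  have hpi := Real.pi_pos
  have hs2 : Real.sqrt 2 * Real.sqrt 2 = 2 := Real.mul_self_sqrt (by norm_num)
  have hs0 : 0 < Real.sqrt 2 := by positivity
  have hs14 : 1 ≤ Real.sqrt 2 := Real.one_le_sqrt.2 (by norm_num)
  set c := t₀ / Real.sqrt 2 with hcdef
  have hc : 0 < c := by positivity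
  have hct : Real.sqrt 2 * c = t₀ := by rw [hcdef]; field_simp
  have hc1 : c ≤ 1 / 20 := by nlinarith
  have h := norm_s1_sub_segment_le n hc hc1
  rw [integral_segment_eq_integral_arc
    (f := fun t => recipGenMain t * Complex.exp (n * t))
    (fun t ht => (differentiableAt_recipGenMain ht).mul (by fun_prop)) hc, hct] at h
  have hInt : IntervalIntegrable (fun φ : ℝ => recipGenMain (t₀ * Complex.exp (φ * Complex.I)) *
      Complex.exp (n * (t₀ * Complex.exp (φ * Complex.I))) *
        (t₀ * Complex.exp (φ * Complex.I))) MeasureTheory.volume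
        (-(Real.pi / 4)) (Real.pi / 4) := by
    refine ContinuousOn.intervalIntegrable fun φ hφ => ContinuousAt.continuousWithinAt ?_
    rw [Set.uIcc_of_le (by linarith)] at hφ
    have hre : 0 < ((t₀ : ℂ) * Complex.exp (φ * Complex.I)).re := by
      rw [Complex.re_ofReal_mul, Complex.exp_ofReal_mul_I_re]
      exact mul_pos ht (Real.cos_pos_of_mem_Ioo ⟨by linarith [hφ.1], by linarith [hφ.2]⟩)
    refine ContinuousAt.mul (ContinuousAt.mul ?_ (by fun_prop)) (by fun_prop)
    exact (differentiableAt_recipGenMain hre).continuousAt.comp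
      (f := fun φ : ℝ => ((t₀ : ℂ) * Complex.exp (φ * Complex.I))) (by fun_prop)
  have hrepart : (∫ φ in (-(Real.pi / 4))..(Real.pi / 4),
      recipGenMain (t₀ * Complex.exp (φ * Complex.I)) *
      Complex.exp (n * (t₀ * Complex.exp (φ * Complex.I))) *
        (t₀ * Complex.exp (φ * Complex.I))).re = t₀ / Real.sqrt 2 * saddleIntegral X t₀ := by
    have hcomm := Complex.reCLM.intervalIntegral_comp_comm hInt
    rw [← Complex.reCLM_apply, ← hcomm, saddleIntegral, ← intervalIntegral.integral_const_mul]
    refine intervalIntegral.integral_congr fun φ hφ => ?_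
    rw [Set.uIcc_of_le (by linarith)] at hφ
    exact recipGenMain_arc_re n ht hX hX' (abs_le.2 hφ)
  have hre := (Complex.abs_re_le_norm _).trans h
  rw [Complex.sub_re, show (1 / (2 * Real.pi) : ℂ) = ((1 / (2 * Real.pi) : ℝ) : ℂ) by
    push_cast; ring, Complex.re_ofReal_mul, hrepart, Complex.ofReal_re] at hre
  have e1 : 1 / (2 * Real.pi) * (t₀ / Real.sqrt 2 * saddleIntegral X t₀) =
      t₀ / (2 * Real.sqrt 2 * Real.pi) * saddleIntegral X t₀ := by field_simp
  rw [e1] at hre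
  refine hre.trans ?_
  exact saddle_error_le n ht hX hX'

/-! ### Laplace's method -/

section GaussianMoments

variable {b : ℝ}

lemma integrable_pow_mul_exp_neg_mul_sq (hb : 0 < b) (n : ℕ) :
    MeasureTheory.Integrable fun x : ℝ => x ^ n * Real.exp (-b * x ^ 2) := by
  have h := integrable_rpow_mul_exp_neg_mul_sq hb (s := n) (by
    have : (0 : ℝ) ≤ n := Nat.cast_nonneg n
    linarith)
  simpa only [Real.rpow_natCast] using h

lemma hasDerivAt_exp_neg_mul_sq (b x : ℝ) :
    HasDerivAt (fun x : ℝ => Real.exp (-b * x ^ 2)) (Real.exp (-b * x ^ 2) * (-b * (2 * x))) x := by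
  have h := ((hasDerivAt_pow 2 x).const_mul (-b)).exp
  simpa using h

lemma integral_sq_mul_exp_neg_mul_sq (hb : 0 < b) :
    ∫ x : ℝ, x ^ 2 * Real.exp (-b * x ^ 2) = Real.sqrt (Real.pi / b) / (2 * b) := by
  have h0 := integrable_pow_mul_exp_neg_mul_sq hb 0
  have h1 := integrable_pow_mul_exp_neg_mul_sq hb 1
  have h2 := integrable_pow_mul_exp_neg_mul_sq hb 2
  simp only [pow_zero, one_mul, pow_one] at h0 h1
  have h := MeasureTheory.integral_eq_zero_of_hasDerivAt_of_integrable
    (f := fun x : ℝ => x * Real.exp (-b * x ^ 2))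
    (f' := fun x : ℝ => Real.exp (-b * x ^ 2) - 2 * b * (x ^ 2 * Real.exp (-b * x ^ 2)))
    (fun x => ((hasDerivAt_id x).mul (hasDerivAt_exp_neg_mul_sq b x)).congr_deriv (by
      simp only [id]; ring)) (h0.sub (h2.const_mul _)) h1
  rw [MeasureTheory.integral_sub h0 (h2.const_mul _), MeasureTheory.integral_const_mul,
    integral_gaussian] at h
  rw [eq_div_iff (by positivity)]
  linarith

lemma integral_pow_four_mul_exp_neg_mul_sq (hb : 0 < b) :
    ∫ x : ℝ, x ^ 4 * Real.exp (-b * x ^ 2) = 3 * Real.sqrt (Real.pi / b) / (4 * b ^ 2) := by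
  have h2 := integrable_pow_mul_exp_neg_mul_sq hb 2
  have h3 := integrable_pow_mul_exp_neg_mul_sq hb 3
  have h4 := integrable_pow_mul_exp_neg_mul_sq hb 4
  have h := MeasureTheory.integral_eq_zero_of_hasDerivAt_of_integrable
    (f := fun x : ℝ => x ^ 3 * Real.exp (-b * x ^ 2))
    (f' := fun x : ℝ => 3 * (x ^ 2 * Real.exp (-b * x ^ 2)) -
      2 * b * (x ^ 4 * Real.exp (-b * x ^ 2)))
    (fun x => ((hasDerivAt_pow 3 x).mul (hasDerivAt_exp_neg_mul_sq b x)).congr_deriv (by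
      push_cast; ring)) ((h2.const_mul _).sub (h4.const_mul _)) h3
  rw [MeasureTheory.integral_sub (h2.const_mul _) (h4.const_mul _),
    MeasureTheory.integral_const_mul, MeasureTheory.integral_const_mul,
    integral_sq_mul_exp_neg_mul_sq hb] at h
  rw [eq_div_iff (by positivity)]
  have hs : 2 * b * (Real.sqrt (Real.pi / b) / (2 * b)) = Real.sqrt (Real.pi / b) := by
    field_simp
  linear_combination 3 * hs - 2 * b * h

end GaussianMoments

lemma abs_cos_sub_quartic_le {x : ℝ} (hx : |x| ≤ 1) :
    |Real.cos x - (1 - x ^ 2 / 2 + x ^ 4 / 24)| ≤ x ^ 6 / 600 := by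
  have hn : ‖(x * Complex.I : ℂ)‖ ≤ 1 := by simpa using hx
  have h := Complex.exp_bound hn (n := 6) (by norm_num)
  have h2 := (Complex.abs_re_le_norm _).trans h
  have hx6 : |x| ^ 6 = x ^ 6 := by
    rw [show 6 = 2 * 3 by norm_num, pow_mul, pow_mul, sq_abs]
  rw [Complex.sub_re, Complex.exp_ofReal_mul_I_re] at h2
  have hI3 : Complex.I ^ 3 = -Complex.I := Complex.I_pow_three
  have e : (∑ m ∈ Finset.range 6, (x * Complex.I : ℂ) ^ m / (m.factorial : ℂ)) =
      ((1 - x ^ 2 / 2 + x ^ 4 / 24 : ℝ) : ℂ) + ((x - x ^ 3 / 6 + x ^ 5 / 120 : ℝ) : ℂ) *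
        Complex.I := by
    simp only [Finset.sum_range_succ, Finset.sum_range_zero, mul_pow]
    have hI4 : Complex.I ^ 4 = 1 := Complex.I_pow_four
    have hI5 : Complex.I ^ 5 = Complex.I := by rw [pow_succ, hI4, one_mul]
    rw [hI5, hI4, hI3, Complex.I_sq]
    simp only [Nat.factorial]
    push_cast
    ring
  rw [e, Complex.add_re, Complex.re_ofReal_mul, Complex.I_re, mul_zero, add_zero,
    Complex.ofReal_re] at h2
  refine h2.trans ?_
  rw [norm_mul, Complex.norm_I, mul_one, Complex.norm_real, Real.norm_eq_abs, hx6]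
  have : 0 ≤ x ^ 6 := by positivity
  norm_num [Nat.factorial]
  nlinarith

lemma quartic_poly_le_exp {z : ℝ} (hz : 0 ≤ z) :
    (z ^ 4 + 2 * z ^ 3 + 6 * z ^ 2) * Real.exp (-(z / 2)) ≤ 7104 * Real.exp (-(z / 4)) := by
  have hz4 : 0 ≤ z / 4 := by positivity
  have h4 := Real.pow_div_factorial_le_exp (z / 4) hz4 4
  have h3 := Real.pow_div_factorial_le_exp (z / 4) hz4 3
  have h2 := Real.pow_div_factorial_le_exp (z / 4) hz4 2
  norm_num [Nat.factorial] at h4 h3 h2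
  have h : z ^ 4 + 2 * z ^ 3 + 6 * z ^ 2 ≤ 7104 * Real.exp (z / 4) := by nlinarith
  calc (z ^ 4 + 2 * z ^ 3 + 6 * z ^ 2) * Real.exp (-(z / 2))
      ≤ 7104 * Real.exp (z / 4) * Real.exp (-(z / 2)) := by gcongr
    _ = 7104 * Real.exp (-(z / 4)) := by
      rw [mul_assoc, ← Real.exp_add]; congr 2; ring

section Laplace

variable {X K g0 g2 : ℝ} {g : ℝ → ℝ}

/-- Comparison with the Gaussian model. The phase exceeds `-X x ^ 2` by
`y = X x ^ 4 / 12 + O(X x ^ 6)`; all errors are polynomials in `z = X x ^ 2` times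
`X ^ (-2) * exp (-z / 2)`, and half of the exponential absorbs the polynomial. -/
lemma laplace_integrand_inside (hX : 0 < X) (h0 : |g0| ≤ K) (h2 : |g2| ≤ K) {x : ℝ}
    (hx : |x| ≤ 1) (hg : |g x - (g0 + g2 * x ^ 2)| ≤ K * x ^ 4) :
    |Real.exp (2 * X * (Real.cos x - 1)) * g x -
      (g0 + g2 * x ^ 2 + g0 * X / 12 * x ^ 4) * Real.exp (-X * x ^ 2)| ≤
      7104 * K / X ^ 2 * Real.exp (-(X / 4) * x ^ 2) := by
  have hK : 0 ≤ K := (abs_nonneg _).trans h0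
  have hx2 : x ^ 2 ≤ 1 := by rw [← sq_abs]; exact pow_le_one₀ (abs_nonneg _) hx
  set y := 2 * X * (Real.cos x - 1) + X * x ^ 2 with hy
  have hc := abs_le.1 (abs_cos_sub_quartic_le hx)
  have hlow := Real.one_sub_sq_div_two_le_cos (x := x)
  have hx4 : 0 ≤ x ^ 4 := by positivity
  have hx6 : x ^ 6 ≤ x ^ 4 := by nlinarith
  have hy0 : 0 ≤ y := by rw [hy]; nlinarith
  have hy1 : y ≤ X * x ^ 4 / 8 := by rw [hy]; nlinarith
  have hy2 : y ≤ X * x ^ 2 / 2 := by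
    have : X * x ^ 4 ≤ X * x ^ 2 := by
      have : x ^ 4 ≤ x ^ 2 := by nlinarith [sq_nonneg x]
      gcongr
    have : 0 ≤ X * x ^ 2 := by positivity
    linarith
  have hy3 : |y - X * x ^ 4 / 12| ≤ X * x ^ 6 / 300 := by
    rw [hy, abs_le]; constructor <;> nlinarith
  have hexp : Real.exp (2 * X * (Real.cos x - 1)) = Real.exp (-X * x ^ 2) * Real.exp y := by
    rw [← Real.exp_add, hy]; congr 1; ring
  have he1 : Real.exp y - 1 ≤ y * Real.exp y := by
    have h := Real.add_one_le_exp (-y)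
    have h' : (1 - y) * Real.exp y ≤ 1 := by
      calc (1 - y) * Real.exp y ≤ Real.exp (-y) * Real.exp y := by gcongr; linarith
        _ = 1 := by rw [← Real.exp_add]; simp
    linarith
  have he0 : 0 ≤ Real.exp y - 1 := by have := Real.add_one_le_exp y; linarith
  have he2 : |Real.exp y - 1 - y| ≤ y ^ 2 * Real.exp y := by
    rw [abs_of_nonneg (by have := Real.add_one_le_exp y; linarith)]
    nlinarith
  have hE := Real.exp_pos y
  have hE1 : 1 ≤ Real.exp y := Real.one_le_exp hy0
  set R := g x - (g0 + g2 * x ^ 2) with hR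
  have hid : Real.exp (2 * X * (Real.cos x - 1)) * g x -
      (g0 + g2 * x ^ 2 + g0 * X / 12 * x ^ 4) * Real.exp (-X * x ^ 2) =
      Real.exp (-X * x ^ 2) * (g0 * (Real.exp y - 1 - y) + g0 * (y - X * x ^ 4 / 12) +
        g2 * (x ^ 2 * (Real.exp y - 1)) + R * Real.exp y) := by
    rw [hexp, hR]; ring
  have hsum : |g0 * (Real.exp y - 1 - y) + g0 * (y - X * x ^ 4 / 12) +
        g2 * (x ^ 2 * (Real.exp y - 1)) + R * Real.exp y| ≤
      K * ((X * x ^ 4) ^ 2 + 2 * (X * x ^ 6) + x ^ 4) * Real.exp y := by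
    have t1 : |g0 * (Real.exp y - 1 - y)| ≤ K * ((X * x ^ 4) ^ 2 * Real.exp y) := by
      rw [abs_mul]
      have : y ^ 2 ≤ (X * x ^ 4) ^ 2 := by
        have : 0 ≤ X * x ^ 4 := by positivity
        exact pow_le_pow_left₀ hy0 (by linarith) 2
      refine mul_le_mul h0 (he2.trans ?_) (abs_nonneg _) hK
      gcongr
    have t2 : |g0 * (y - X * x ^ 4 / 12)| ≤ K * (X * x ^ 6 * Real.exp y) := by
      rw [abs_mul]
      have h6 : 0 ≤ X * x ^ 6 := by positivity
      refine mul_le_mul h0 (hy3.trans ?_) (abs_nonneg _) hK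
      nlinarith
    have t3 : |g2 * (x ^ 2 * (Real.exp y - 1))| ≤ K * (X * x ^ 6 * Real.exp y) := by
      rw [abs_mul, abs_of_nonneg (mul_nonneg (sq_nonneg x) he0)]
      refine mul_le_mul h2 ?_ (mul_nonneg (sq_nonneg x) he0) hK
      calc x ^ 2 * (Real.exp y - 1) ≤ x ^ 2 * (X * x ^ 4 * Real.exp y) := by
            have : 0 ≤ X * x ^ 4 := by positivity
            have : y ≤ X * x ^ 4 := by linarith
            have : Real.exp y - 1 ≤ X * x ^ 4 * Real.exp y := he1.trans (by gcongr)
            gcongr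
        _ = _ := by ring
    have t4 : |R * Real.exp y| ≤ K * x ^ 4 * Real.exp y := by
      rw [abs_mul, abs_of_pos hE]; gcongr
    refine (abs_add_le _ _).trans ?_
    refine (add_le_add ((abs_add_le _ _).trans (add_le_add (abs_add_le _ _) le_rfl))
      le_rfl).trans ?_
    linarith
  rw [hid, abs_mul, abs_of_pos (Real.exp_pos _)]
  have hz0 : 0 ≤ X * x ^ 2 := by positivity
  have hq := quartic_poly_le_exp hz0
  have hp : K * ((X * x ^ 4) ^ 2 + 2 * (X * x ^ 6) + x ^ 4) ≤
      K / X ^ 2 * ((X * x ^ 2) ^ 4 + 2 * (X * x ^ 2) ^ 3 + 6 * (X * x ^ 2) ^ 2) := by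
    have e : K / X ^ 2 * ((X * x ^ 2) ^ 4 + 2 * (X * x ^ 2) ^ 3 + 6 * (X * x ^ 2) ^ 2) =
      K * ((X * x ^ 4) ^ 2 + 2 * (X * x ^ 6) + 6 * x ^ 4) := by field_simp
    rw [e]
    gcongr
    linarith
  calc Real.exp (-X * x ^ 2) * _ ≤ Real.exp (-X * x ^ 2) *
        (K * ((X * x ^ 4) ^ 2 + 2 * (X * x ^ 6) + x ^ 4) * Real.exp (X * x ^ 2 / 2)) := by
        gcongr
        refine hsum.trans ?_
        gcongr
    _ = K * ((X * x ^ 4) ^ 2 + 2 * (X * x ^ 6) + x ^ 4) * Real.exp (-(X * x ^ 2 / 2)) := by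
        rw [mul_left_comm, ← Real.exp_add]; congr 2; ring
    _ ≤ K / X ^ 2 * ((X * x ^ 2) ^ 4 + 2 * (X * x ^ 2) ^ 3 + 6 * (X * x ^ 2) ^ 2) *
        Real.exp (-(X * x ^ 2 / 2)) := by gcongr
    _ ≤ K / X ^ 2 * (7104 * Real.exp (-(X * x ^ 2 / 4))) := by
        rw [mul_assoc]
        gcongr
    _ = _ := by
        rw [show -(X * x ^ 2 / 4) = -(X / 4) * x ^ 2 by ring]; ring

/-- The tail of the Gaussian model obeys the same bound as the error of the integrand, so that the
two can be integrated over the whole line together. -/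
lemma laplace_integrand_outside (hX : 0 < X) (h0 : |g0| ≤ K) (h2 : |g2| ≤ K) {x : ℝ}
    (hx : 1 / 2 ≤ x ^ 2) :
    |(g0 + g2 * x ^ 2 + g0 * X / 12 * x ^ 4) * Real.exp (-X * x ^ 2)| ≤
      7104 * K / X ^ 2 * Real.exp (-(X / 4) * x ^ 2) := by
  have hK : 0 ≤ K := (abs_nonneg _).trans h0
  have hz0 : 0 ≤ X * x ^ 2 := by positivity
  have hq := quartic_poly_le_exp hz0
  rw [abs_mul, abs_of_pos (Real.exp_pos _)]
  have hx4 : x ^ 2 ≤ 2 * x ^ 4 := by nlinarith [sq_nonneg x]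
  have hx6 : x ^ 4 ≤ 2 * x ^ 6 := by nlinarith [sq_nonneg (x ^ 2)]
  have hsum : |g0 + g2 * x ^ 2 + g0 * X / 12 * x ^ 4| ≤ K * (2 * (X * x ^ 6) + 6 * x ^ 4) := by
    have t2 : |g2 * x ^ 2| ≤ K * x ^ 2 := by
      rw [abs_mul, abs_of_nonneg (sq_nonneg x)]; gcongr
    have t3 : |g0 * X / 12 * x ^ 4| ≤ K * X * x ^ 4 := by
      rw [show g0 * X / 12 * x ^ 4 = g0 * (X / 12 * x ^ 4) by ring, abs_mul,
        abs_of_nonneg (by positivity : 0 ≤ X / 12 * x ^ 4), mul_assoc]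
      have : 0 ≤ X * x ^ 4 := by positivity
      refine mul_le_mul h0 (by linarith) (by positivity) hK
    have t4 : K * (1 + x ^ 2 + X * x ^ 4) ≤ K * (2 * (X * x ^ 6) + 6 * x ^ 4) := by
      have h1 : X * x ^ 4 ≤ X * (2 * x ^ 6) := by gcongr
      have h2 : 1 ≤ 4 * x ^ 4 := by nlinarith
      exact mul_le_mul_of_nonneg_left (by linarith) hK
    refine (abs_add_le _ _).trans ?_
    refine (add_le_add (abs_add_le _ _) le_rfl).trans ?_
    linarith
  have hp : K * (2 * (X * x ^ 6) + 6 * x ^ 4) ≤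
      K / X ^ 2 * ((X * x ^ 2) ^ 4 + 2 * (X * x ^ 2) ^ 3 + 6 * (X * x ^ 2) ^ 2) := by
    have e : K / X ^ 2 * ((X * x ^ 2) ^ 4 + 2 * (X * x ^ 2) ^ 3 + 6 * (X * x ^ 2) ^ 2) =
      K * ((X * x ^ 4) ^ 2 + 2 * (X * x ^ 6) + 6 * x ^ 4) := by field_simp
    rw [e]
    gcongr
    nlinarith [sq_nonneg (X * x ^ 4)]
  have hexp : Real.exp (-X * x ^ 2) ≤ Real.exp (-(X * x ^ 2 / 2)) :=
    Real.exp_le_exp.2 (by linarith)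
  calc _ ≤ K / X ^ 2 * ((X * x ^ 2) ^ 4 + 2 * (X * x ^ 2) ^ 3 + 6 * (X * x ^ 2) ^ 2) *
        Real.exp (-(X * x ^ 2 / 2)) := by
        refine mul_le_mul (hsum.trans hp) hexp (Real.exp_pos _).le (by positivity)
    _ ≤ K / X ^ 2 * (7104 * Real.exp (-(X * x ^ 2 / 4))) := by
        rw [mul_assoc]
        gcongr
    _ = _ := by
        rw [show -(X * x ^ 2 / 4) = -(X / 4) * x ^ 2 by ring]; ring

/-- Laplace's method with two terms for the phase `2 (cos x - 1)`. The correction `g0 / 16` comes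
from the quartic term `x ^ 4 / 12` of the phase. -/
theorem laplace_cos (hX : 0 < X) (h0 : |g0| ≤ K) (h2 : |g2| ≤ K) (hgc : Continuous g)
    (hg : ∀ x, |x| ≤ 1 → |g x - (g0 + g2 * x ^ 2)| ≤ K * x ^ 4) :
    |(∫ x in (-(Real.pi / 4))..(Real.pi / 4), Real.exp (2 * X * (Real.cos x - 1)) * g x) -
      Real.sqrt (Real.pi / X) * (g0 + (g2 / 2 + g0 / 16) / X)| ≤
      14208 * K / X ^ 2 * Real.sqrt (Real.pi / X) := by
  have hpi := Real.pi_gt_three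
  have hpi4 := Real.pi_lt_d2
  set a := Real.pi / 4 with ha
  let f : ℝ → ℝ := fun x => Real.exp (2 * X * (Real.cos x - 1)) * g x
  let p : ℝ → ℝ := fun x =>
    (g0 + g2 * x ^ 2 + g0 * X / 12 * x ^ 4) * Real.exp (-X * x ^ 2)
  have hf : Continuous f := by fun_prop
  have hm0 : MeasureTheory.Integrable fun x : ℝ => Real.exp (-X * x ^ 2) := by
    simpa using integrable_pow_mul_exp_neg_mul_sq hX 0
  have hm2 := integrable_pow_mul_exp_neg_mul_sq hX 2
  have hm4 := integrable_pow_mul_exp_neg_mul_sq hX 4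
  have hpe : p = fun x => g0 * Real.exp (-X * x ^ 2) + g2 * (x ^ 2 * Real.exp (-X * x ^ 2)) +
      g0 * X / 12 * (x ^ 4 * Real.exp (-X * x ^ 2)) := by
    ext x; simp only [p]; ring
  have hm02 : MeasureTheory.Integrable fun x : ℝ =>
      g0 * Real.exp (-X * x ^ 2) + g2 * (x ^ 2 * Real.exp (-X * x ^ 2)) :=
    (hm0.const_mul _).add (hm2.const_mul _)
  have hpint : MeasureTheory.Integrable p := by
    rw [hpe]
    exact hm02.add (hm4.const_mul _)
  have hpval : ∫ x, p x = Real.sqrt (Real.pi / X) * (g0 + (g2 / 2 + g0 / 16) / X) := by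
    rw [hpe, MeasureTheory.integral_add hm02 (hm4.const_mul _),
      MeasureTheory.integral_add (hm0.const_mul _) (hm2.const_mul _),
      MeasureTheory.integral_const_mul, MeasureTheory.integral_const_mul,
      MeasureTheory.integral_const_mul, integral_gaussian, integral_sq_mul_exp_neg_mul_sq hX,
      integral_pow_four_mul_exp_neg_mul_sq hX]
    field_simp
    ring
  have hS : MeasurableSet (Set.Ioc (-a) a) := measurableSet_Ioc
  have hfint : MeasureTheory.Integrable ((Set.Ioc (-a) a).indicator f) := by
    rw [MeasureTheory.integrable_indicator_iff hS]
    exact (hf.integrableOn_Icc).mono_set Set.Ioc_subset_Icc_self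
  have hfval : ∫ x in (-a)..a, f x = ∫ x, (Set.Ioc (-a) a).indicator f x := by
    rw [MeasureTheory.integral_indicator hS, intervalIntegral.integral_of_le (by linarith)]
  have hbint : MeasureTheory.Integrable fun x : ℝ =>
      7104 * K / X ^ 2 * Real.exp (-(X / 4) * x ^ 2) := by
    refine MeasureTheory.Integrable.const_mul ?_ _
    simpa using integrable_pow_mul_exp_neg_mul_sq (b := X / 4) (by positivity) 0
  have hb : ∀ x, ‖(Set.Ioc (-a) a).indicator f x - p x‖ ≤
      7104 * K / X ^ 2 * Real.exp (-(X / 4) * x ^ 2) := by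
    intro x
    rw [Real.norm_eq_abs]
    by_cases hx : x ∈ Set.Ioc (-a) a
    · rw [Set.indicator_of_mem hx]
      have hx1 : |x| ≤ 1 := abs_le.2 ⟨by linarith [hx.1], by linarith [hx.2]⟩
      exact laplace_integrand_inside hX h0 h2 hx1 (hg x hx1)
    · rw [Set.indicator_of_notMem hx, zero_sub, abs_neg]
      refine laplace_integrand_outside hX h0 h2 ?_
      have hax : a ≤ |x| := by
        by_contra h
        push Not at h
        have := abs_lt.1 h
        exact hx ⟨this.1, this.2.le⟩
      rw [← sq_abs x]
      nlinarith
  change |(∫ x in (-a)..a, f x) - _| ≤ _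
  rw [← hpval, hfval, ← MeasureTheory.integral_sub hfint hpint]
  have h := MeasureTheory.norm_integral_le_of_norm_le hbint (Eventually.of_forall hb)
  rw [Real.norm_eq_abs] at h
  refine h.trans (le_of_eq ?_)
  rw [MeasureTheory.integral_const_mul, integral_gaussian]
  have : Real.sqrt (Real.pi / (X / 4)) = 2 * Real.sqrt (Real.pi / X) := by
    rw [show Real.pi / (X / 4) = 2 ^ 2 * (Real.pi / X) by field_simp; norm_num,
      Real.sqrt_mul (by norm_num), Real.sqrt_sq (by norm_num)]
  rw [this]
  ring

end Laplace

lemma abs_trig_combination_sub_le (α β γ : ℝ) {x : ℝ} (hx : |x| ≤ 1) :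
    |(α * Real.cos x + β * (x * Real.sin x) + γ * Real.cos (2 * x)) -
      ((α + γ) + (-α / 2 + β - 2 * γ) * x ^ 2)| ≤ (|α| + |β| + 2 * |γ|) * x ^ 4 := by
  have hc := Real.cos_bound hx
  have hs := Real.sin_bound hx
  have hx4 : |x| ^ 4 = x ^ 4 := by
    rw [show 4 = 2 * 2 by norm_num, pow_mul, pow_mul, sq_abs]
  rw [hx4] at hc
  have hs : |Real.sin x - (x - x ^ 3 / 6)| ≤ x ^ 4 * (5 / 96) := by
    refine hs.trans ?_
    have : |x| ^ 5 ≤ |x| ^ 4 := pow_le_pow_of_le_one (abs_nonneg _) hx (by norm_num)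
    have : 0 ≤ x ^ 4 := by positivity
    linarith
  have hx40 : 0 ≤ x ^ 4 := by positivity
  have hx2 : x ^ 2 ≤ 1 := by rw [← sq_abs]; exact pow_le_one₀ (abs_nonneg _) hx
  set e := Real.cos x - (1 - x ^ 2 / 2) with he
  have t1 : |Real.cos x - 1 + x ^ 2 / 2| ≤ x ^ 4 := by
    rw [show Real.cos x - 1 + x ^ 2 / 2 = e by rw [he]; ring]
    linarith
  have t2 : |x * Real.sin x - x ^ 2| ≤ x ^ 4 := by
    have e2 : x * Real.sin x - x ^ 2 =
        x * (Real.sin x - (x - x ^ 3 / 6)) - x ^ 4 / 6 := by ring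
    rw [e2]
    refine (abs_sub _ _).trans ?_
    rw [abs_mul, abs_of_nonneg (by positivity : 0 ≤ x ^ 4 / 6)]
    have : |x| * |Real.sin x - (x - x ^ 3 / 6)| ≤ 1 * (x ^ 4 * (5 / 96)) := by gcongr
    linarith
  have t3 : |Real.cos (2 * x) - 1 + 2 * x ^ 2| ≤ 2 * x ^ 4 := by
    have e3 : Real.cos (2 * x) - 1 + 2 * x ^ 2 = x ^ 4 / 2 + e * (4 - 2 * x ^ 2 + 2 * e) := by
      rw [Real.cos_two_mul, he]; ring
    rw [e3]
    refine (abs_add_le _ _).trans ?_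
    rw [abs_mul, abs_of_nonneg (by positivity : 0 ≤ x ^ 4 / 2)]
    have hx41 : x ^ 4 ≤ 1 := by nlinarith [sq_nonneg x]
    have h5 : |4 - 2 * x ^ 2 + 2 * e| ≤ 5 := by
      have := abs_le.1 hc
      rw [abs_le]
      constructor <;> nlinarith [sq_nonneg x]
    have : |e| * |4 - 2 * x ^ 2 + 2 * e| ≤ (x ^ 4 * (5 / 96)) * 5 := by gcongr
    linarith
  have hid : (α * Real.cos x + β * (x * Real.sin x) + γ * Real.cos (2 * x)) -
      ((α + γ) + (-α / 2 + β - 2 * γ) * x ^ 2) = α * (Real.cos x - 1 + x ^ 2 / 2) +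
      β * (x * Real.sin x - x ^ 2) + γ * (Real.cos (2 * x) - 1 + 2 * x ^ 2) := by ring
  rw [hid]
  refine (abs_add_le _ _).trans ((add_le_add (abs_add_le _ _) le_rfl).trans ?_)
  rw [abs_mul, abs_mul, abs_mul]
  have u1 : |α| * |Real.cos x - 1 + x ^ 2 / 2| ≤ |α| * x ^ 4 := by gcongr
  have u2 : |β| * |x * Real.sin x - x ^ 2| ≤ |β| * x ^ 4 := by gcongr
  have u3 : |γ| * |Real.cos (2 * x) - 1 + 2 * x ^ 2| ≤ |γ| * (2 * x ^ 4) := by gcongr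
  linarith

theorem abs_saddleIntegral_sub_le {X : ℝ} (t₀ : ℝ) (hX : 0 < X) (ℓ : ℝ)
    (hℓ : ℓ = Real.log (Real.pi / (2 * t₀))) :
    |Real.exp (-(2 * X)) * saddleIntegral X t₀ - Real.sqrt (Real.pi / X) *
      (ℓ / 2 * (1 - 3 / (16 * X)) + 1 / (4 * X) + t₀ / 8 * (1 - 15 / (16 * X)))| ≤
      14208 * (|ℓ| + 1 + |t₀|) / X ^ 2 * Real.sqrt (Real.pi / X) := by
  set K := |ℓ| + 1 + |t₀| with hK
  have a1 := abs_nonneg ℓ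
  have a2 := abs_nonneg t₀
  have b1 : |ℓ / 2| = |ℓ| / 2 := by rw [abs_div]; norm_num
  have b2 : |t₀ / 8| = |t₀| / 8 := by rw [abs_div]; norm_num
  have b3 : |(1 / 2 : ℝ)| = 1 / 2 := by norm_num
  have h0 : |ℓ / 2 + t₀ / 8| ≤ K := by
    refine (abs_add_le _ _).trans ?_
    rw [b1, b2, hK]; linarith
  have h2 : |-(ℓ / 2) / 2 + 1 / 2 - 2 * (t₀ / 8)| ≤ K := by
    have c1 := abs_le.1 (le_refl |ℓ|)
    have c2 := abs_le.1 (le_refl |t₀|)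
    rw [abs_le, hK]
    constructor <;> linarith [c1.1, c1.2, c2.1, c2.2]
  have hL := laplace_cos (g := fun x => ℓ / 2 * Real.cos x + 1 / 2 * (x * Real.sin x) +
      t₀ / 8 * Real.cos (2 * x)) hX h0 h2 (by fun_prop) (fun x hx => by
    refine (abs_trig_combination_sub_le _ _ _ hx).trans ?_
    rw [b1, b2, b3]
    gcongr
    rw [hK]; linarith)
  have e1 : Real.exp (-(2 * X)) * saddleIntegral X t₀ =
      ∫ x in (-(Real.pi / 4))..(Real.pi / 4), Real.exp (2 * X * (Real.cos x - 1)) *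
        (ℓ / 2 * Real.cos x + 1 / 2 * (x * Real.sin x) + t₀ / 8 * Real.cos (2 * x)) := by
    rw [saddleIntegral, ← intervalIntegral.integral_const_mul, ← hℓ]
    refine intervalIntegral.integral_congr fun x _ => ?_
    rw [← mul_assoc, ← Real.exp_add]
    rw [show -(2 * X) + 2 * X * Real.cos x = 2 * X * (Real.cos x - 1) by ring]
    ring
  have e2 : ℓ / 2 * (1 - 3 / (16 * X)) + 1 / (4 * X) + t₀ / 8 * (1 - 15 / (16 * X)) =
      ℓ / 2 + t₀ / 8 + ((-(ℓ / 2) / 2 + 1 / 2 - 2 * (t₀ / 8)) / 2 + (ℓ / 2 + t₀ / 8) / 16) / X := by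
    field_simp
    ring
  rw [e1, e2]
  exact hL

/-! ### The asymptotic expansion -/

/-- The two-term saddle point value of `s1 n`, relative to `√3 / (4 w ^ (3/2)) * exp (π w / 3)`,
in terms of `w = √(3 (n + 1 / 24))`. -/
noncomputable def saddleBracket (w : ℝ) : ℝ :=
  Real.log w / 2 * (1 - 9 / (8 * Real.pi * w)) + 3 / (2 * Real.pi * w) +
    Real.pi / (16 * w) * (1 - 45 / (8 * Real.pi * w))

/-- The bound for the relative error of `saddleBracket`. -/
noncomputable def saddleError (w : ℝ) : ℝ :=
  14208 * (Real.log w + 1 + Real.pi / (2 * w)) / (Real.pi * w / 6) ^ 2 +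
    900 * (Real.pi * w / 6) ^ 2 * Real.exp (-(0.04 * (Real.pi * w / 6))) *
      (4 * (w * Real.sqrt w) / Real.sqrt 3)

lemma abs_s1_div_sub_saddleBracket_le (n : ℕ) {w : ℝ} (hw : 10 * Real.pi ≤ w)
    (hwn : w ^ 2 = 3 * (n + 1 / 24)) :
    |s1 n / (Real.sqrt 3 / (4 * (w * Real.sqrt w)) * Real.exp (Real.pi * w / 3)) -
      saddleBracket w| ≤ saddleError w := by
  have hpi := Real.pi_gt_three
  have hw0 : 0 < w := by linarith
  have hw1 : 1 ≤ w := by linarith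
  set t₀ := Real.pi / (2 * w) with ht₀
  set X := Real.pi * w / 6 with hXdef
  have ht0 : 0 < t₀ := by positivity
  have hX0 : 0 < X := by positivity
  have ht1 : t₀ ≤ 1 / 20 := by
    rw [ht₀, div_le_div_iff₀ (by positivity) (by norm_num)]; linarith
  have hX : ((n : ℝ) + 1 / 24) * t₀ = X := by
    have : (n : ℝ) + 1 / 24 = w ^ 2 / 3 := by rw [hwn]; ring
    rw [this, ht₀, hXdef]; field_simp; norm_num
  have hX' : Real.pi ^ 2 / (12 * t₀) = X := by
    rw [ht₀, hXdef]; field_simp; norm_num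
  have h1 := abs_s1_sub_saddle_le n ht0 ht1 hX hX'
  have hℓ : Real.log w = Real.log (Real.pi / (2 * t₀)) := by
    congr 1; rw [ht₀]; field_simp
  have h2 := abs_saddleIntegral_sub_le t₀ hX0 (Real.log w) hℓ
  rw [abs_of_nonneg (Real.log_nonneg hw1), abs_of_pos ht0] at h2
  have hB : Real.log w / 2 * (1 - 3 / (16 * X)) + 1 / (4 * X) + t₀ / 8 * (1 - 15 / (16 * X)) =
      saddleBracket w := by
    rw [saddleBracket, ht₀, hXdef]
    field_simp
    ring
  rw [hB] at h2
  set A := t₀ / (2 * Real.sqrt 2 * Real.pi) with hA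
  have hA0 : 0 < A := by positivity
  have hS0 : 0 < Real.sqrt (Real.pi / X) := Real.sqrt_pos.2 (by positivity)
  have hAS : A * Real.sqrt (Real.pi / X) = Real.sqrt 3 / (4 * (w * Real.sqrt w)) := by
    have e : Real.pi / X = 3 * 2 / w := by rw [hXdef]; field_simp; norm_num
    rw [e, Real.sqrt_div (by norm_num), Real.sqrt_mul (by norm_num), hA, ht₀]
    field_simp
    norm_num
  have hexp : Real.exp (Real.pi * w / 3) = Real.exp (2 * X) := by
    congr 1; rw [hXdef]; ring
  rw [← hAS, hexp]
  set P := A * Real.sqrt (Real.pi / X) * Real.exp (2 * X) with hP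
  have hP0 : 0 < P := by positivity
  set J := saddleIntegral X t₀
  have hJ : A * J = P * (Real.exp (-(2 * X)) * J / Real.sqrt (Real.pi / X)) := by
    have : Real.exp (2 * X) * Real.exp (-(2 * X)) = 1 := by rw [← Real.exp_add]; simp
    have e : P * (Real.exp (-(2 * X)) * J / Real.sqrt (Real.pi / X)) =
        A * J * (Real.exp (2 * X) * Real.exp (-(2 * X))) *
          (Real.sqrt (Real.pi / X) / Real.sqrt (Real.pi / X)) := by rw [hP]; ring
    rw [e, this, div_self hS0.ne', mul_one, mul_one]
  have hsplit : s1 n / P - saddleBracket w = (s1 n - A * J) / P +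
      (Real.exp (-(2 * X)) * J - Real.sqrt (Real.pi / X) * saddleBracket w) /
        Real.sqrt (Real.pi / X) := by
    rw [sub_div, hJ, mul_div_cancel_left₀ _ hP0.ne', sub_div, mul_div_cancel_left₀ _ hS0.ne']
    ring
  rw [hsplit]
  refine (abs_add_le _ _).trans ?_
  rw [abs_div, abs_div, abs_of_pos hP0, abs_of_pos hS0, saddleError, ← hXdef, ← ht₀, add_comm]
  refine add_le_add ?_ ?_
  · rw [div_le_iff₀ hS0]
    exact h2
  · rw [div_le_iff₀ hP0]
    refine h1.trans (le_of_eq ?_)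
    have e : Real.exp (1.96 * X) = Real.exp (-(0.04 * X)) * Real.exp (2 * X) := by
      rw [← Real.exp_add]; congr 1; ring
    have h3 : Real.sqrt 3 ≠ 0 := by positivity
    rw [e, hP, hAS]
    field_simp

lemma saddleError_isBigO : saddleError =O[atTop] fun w => Real.log w / w ^ 2 := by
  have hpi := Real.pi_gt_three
  have hlog1 : ∀ᶠ w : ℝ in atTop, 1 ≤ Real.log w := Real.tendsto_log_atTop.eventually_ge_atTop 1
  refine IsBigO.add ?_ ?_
  · refine IsBigO.of_bound (14208 * 12) ?_
    filter_upwards [hlog1, eventually_ge_atTop (2 * Real.pi)] with w hl hw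
    have hw0 : 0 < w := by linarith
    have h1 : Real.pi / (2 * w) ≤ 1 := by rw [div_le_one (by positivity)]; linarith
    rw [Real.norm_of_nonneg (by positivity), Real.norm_of_nonneg (by positivity)]
    have h2 : w / 2 ≤ Real.pi * w / 6 := by nlinarith
    calc 14208 * (Real.log w + 1 + Real.pi / (2 * w)) / (Real.pi * w / 6) ^ 2
        ≤ 14208 * (Real.log w + Real.log w + Real.log w) / (w / 2) ^ 2 := by
          gcongr
          linarith
      _ = 14208 * 12 * (Real.log w / w ^ 2) := by field_simp; ring
      _ = _ := by norm_num
  · have hb : (0 : ℝ) < 0.04 * (Real.pi / 6) := by positivity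
    have ho := (isLittleO_pow_exp_pos_mul_atTop 6 hb).bound (show (0 : ℝ) < 1 by norm_num)
    refine IsBigO.of_bound (900 * Real.pi ^ 2 * 4) ?_
    filter_upwards [hlog1, eventually_ge_atTop (1 : ℝ), ho] with w hl hw h
    have hw0 : 0 < w := by linarith
    rw [Real.norm_of_nonneg (by positivity), Real.norm_of_nonneg (by positivity)]
    rw [Real.norm_of_nonneg (by positivity), Real.norm_of_nonneg (by positivity), one_mul] at h
    have hs : Real.sqrt w ≤ w := by
      rw [Real.sqrt_le_left (by linarith)]; nlinarith
    have hs3 : 1 ≤ Real.sqrt 3 := Real.one_le_sqrt.2 (by norm_num)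
    have he : Real.exp (-(0.04 * (Real.pi * w / 6))) ≤ 1 / w ^ 6 := by
      rw [Real.exp_neg, inv_eq_one_div]
      refine one_div_le_one_div_of_le (by positivity) (h.trans (le_of_eq ?_))
      congr 1; ring
    calc 900 * (Real.pi * w / 6) ^ 2 * Real.exp (-(0.04 * (Real.pi * w / 6))) *
          (4 * (w * Real.sqrt w) / Real.sqrt 3)
        ≤ 900 * (Real.pi * w / 1) ^ 2 * (1 / w ^ 6) * (4 * (w * w) / 1) := by
          gcongr
          norm_num
      _ = 900 * Real.pi ^ 2 * 4 * (1 / w ^ 2) := by field_simp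
      _ ≤ _ := by gcongr

section Shift

variable {v w : ℝ}

lemma shift_bounds (hv : 2 ≤ v) (hw : 0 < w) (hvw : w ^ 2 = v ^ 2 + 1 / 8) :
    v ≤ w ∧ w - v ≤ 1 / (16 * v) ∧ |w - v - 1 / (16 * v)| ≤ 1 / v ^ 2 := by
  have hv0 : 0 < v := by linarith
  have h1 : v ≤ w := by
    by_contra h
    push Not at h
    nlinarith
  have h2 : w - v = 1 / (8 * (w + v)) := by
    rw [eq_div_iff (by positivity)]
    linear_combination 8 * hvw
  have h3 : w - v ≤ 1 / (16 * v) := by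
    rw [h2]
    exact one_div_le_one_div_of_le (by positivity) (by linarith)
  refine ⟨h1, h3, ?_⟩
  have h4 : w - v - 1 / (16 * v) = -((w - v) * (1 / (16 * v * (w + v)))) := by
    nth_rewrite 1 [h2]
    field_simp
    ring
  rw [h4, abs_neg, abs_of_nonneg (mul_nonneg (by linarith) (by positivity))]
  have h5 : w - v ≤ 1 := h3.trans (by rw [div_le_one (by positivity)]; linarith)
  have h6 : 1 / (16 * v * (w + v)) ≤ 1 / v ^ 2 :=
    one_div_le_one_div_of_le (by positivity) (by nlinarith)
  calc (w - v) * (1 / (16 * v * (w + v))) ≤ 1 * (1 / v ^ 2) := by gcongr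
    _ = _ := one_mul _

/-- Passing from `n + 1 / 24` to `n` in the exponential factor produces the term
`π / (48 √(3 n))`. -/
lemma abs_prefactor_ratio_sub_le (hv : 2 ≤ v) (hw : 0 < w) (hvw : w ^ 2 = v ^ 2 + 1 / 8) :
    |v * Real.sqrt v / (w * Real.sqrt w) * Real.exp (Real.pi * (w - v) / 3) -
      (1 + Real.pi / (48 * v))| ≤ 4 / v ^ 2 := by
  have hpi := Real.pi_gt_three
  have hpi4 := Real.pi_lt_d2
  obtain ⟨h1, h2, h3⟩ := shift_bounds hv hw hvw
  have hv0 : 0 < v := by linarith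
  set a := v * Real.sqrt v / (w * Real.sqrt w) with ha
  set s := Real.pi * (w - v) / 3 with hs
  have hsv : Real.sqrt v ≤ Real.sqrt w := Real.sqrt_le_sqrt h1
  have hsv0 : 0 < Real.sqrt v := Real.sqrt_pos.2 hv0
  have hsw0 : 0 < Real.sqrt w := Real.sqrt_pos.2 hw
  have ha1 : a ≤ 1 := by
    rw [ha, div_le_one (by positivity)]; gcongr
  have hq : v / w ≤ Real.sqrt v / Real.sqrt w := by
    rw [div_le_div_iff₀ hw hsw0]
    nlinarith [Real.mul_self_sqrt hv0.le, Real.mul_self_sqrt hw.le, mul_pos hsv0 hsw0]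
  have ha2 : 1 - 1 / (8 * v ^ 2) ≤ a := by
    have e1 : a = v / w * (Real.sqrt v / Real.sqrt w) := by rw [ha]; field_simp
    have e2 : v / w * (v / w) ≤ a := by rw [e1]; gcongr
    refine le_trans ?_ e2
    have e3 : v / w * (v / w) = v ^ 2 / (v ^ 2 + 1 / 8) := by rw [← hvw]; field_simp
    rw [e3, le_div_iff₀ (by positivity)]
    have : (1 - 1 / (8 * v ^ 2)) * (v ^ 2 + 1 / 8) = v ^ 2 - 1 / (64 * v ^ 2) := by
      field_simp; ring
    rw [this]
    have : 0 < 1 / (64 * v ^ 2) := by positivity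
    linarith
  have hs0 : 0 ≤ s := by rw [hs]; have := sub_nonneg.2 h1; positivity
  have hinv : 1 / (16 * v) = 1 / v / 16 := by field_simp
  have hiv : 1 / v ≤ 1 / 2 := one_div_le_one_div_of_le (by norm_num) hv
  have hiv0 : 0 < 1 / v := by positivity
  have hs1 : s ≤ 1 / v := by
    rw [hinv] at h2
    have : Real.pi * (w - v) ≤ 3.15 * (1 / v / 16) := by
      have := sub_nonneg.2 h1
      gcongr
    rw [hs]
    linarith
  have he := Real.abs_exp_sub_one_sub_id_le (x := s) (by rw [abs_of_nonneg hs0]; linarith)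
  have hsq : s ^ 2 ≤ 1 / v ^ 2 := by
    have := pow_le_pow_left₀ hs0 hs1 2
    rwa [one_div_pow] at this
  have hp : |s - Real.pi / (48 * v)| ≤ 1.05 * (1 / v ^ 2) := by
    have e : s - Real.pi / (48 * v) = Real.pi / 3 * (w - v - 1 / (16 * v)) := by
      rw [hs]; field_simp; ring
    rw [e, abs_mul, abs_of_pos (by positivity : 0 < Real.pi / 3)]
    have : Real.pi / 3 ≤ 1.05 := by linarith
    gcongr
  have hE : Real.exp s ≤ 2 := by
    have := (abs_le.1 he).2
    nlinarith
  have hid : a * Real.exp s - (1 + Real.pi / (48 * v)) = (a - 1) * Real.exp s +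
      (Real.exp s - 1 - s) + (s - Real.pi / (48 * v)) := by ring
  rw [hid]
  refine (abs_add_le _ _).trans ((add_le_add (abs_add_le _ _) le_rfl).trans ?_)
  have hA : |(a - 1) * Real.exp s| ≤ 1 / (8 * v ^ 2) * 2 := by
    rw [abs_mul, abs_of_pos (Real.exp_pos _), abs_of_nonpos (by linarith)]
    gcongr
    linarith
  have e8 : 1 / (8 * v ^ 2) * 2 = 1 / v ^ 2 / 4 := by field_simp; norm_num
  have e4 : 4 / v ^ 2 = 4 * (1 / v ^ 2) := by ring
  have : 0 < 1 / v ^ 2 := by positivity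
  rw [e4]
  linarith

lemma abs_saddleBracket_sub_le (hv : 2 ≤ v) (hw : 0 < w) (hvw : w ^ 2 = v ^ 2 + 1 / 8) :
    |4 * saddleBracket w - (2 * Real.log v - 9 / (4 * Real.pi) * (Real.log v / v) +
      (6 / Real.pi + Real.pi / 4) * (1 / v))| ≤ (7 + Real.log v) / v ^ 2 := by
  have hpi := Real.pi_gt_three
  have hpi4 := Real.pi_lt_d2
  obtain ⟨h1, h2, _⟩ := shift_bounds hv hw hvw
  have hv0 : 0 < v := by linarith
  have hlv : 0 ≤ Real.log v := Real.log_nonneg (by linarith)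
  have hlog0 : Real.log v ≤ Real.log w := Real.log_le_log hv0 h1
  have hvsq : 0 < 1 / v ^ 2 := by positivity
  have hlog1 : Real.log w - Real.log v ≤ 1 / v ^ 2 / 16 := by
    rw [← Real.log_div hw.ne' hv0.ne']
    refine (Real.log_le_sub_one_of_pos (by positivity)).trans ?_
    have : w / v - 1 = (w - v) * (1 / v) := by field_simp
    rw [this]
    calc (w - v) * (1 / v) ≤ 1 / (16 * v) * (1 / v) := by gcongr
      _ = _ := by field_simp
  have hinv0 : 1 / w ≤ 1 / v := one_div_le_one_div_of_le hv0 h1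
  have hinv1 : 1 / v - 1 / w ≤ 1 / v ^ 2 / 16 := by
    have e : 1 / v - 1 / w = (w - v) * (1 / (v * w)) := by field_simp
    rw [e]
    have h3 : w - v ≤ 1 / 16 := h2.trans (by
      rw [div_le_div_iff₀ (by positivity) (by norm_num)]; linarith)
    have h4 : 1 / (v * w) ≤ 1 / v ^ 2 := one_div_le_one_div_of_le (by positivity) (by nlinarith)
    calc (w - v) * (1 / (v * w)) ≤ 1 / 16 * (1 / v ^ 2) := by gcongr
      _ = _ := by ring
  have hiw : 0 < 1 / w := by positivity
  have hiw1 : 1 / w ≤ 1 := by rw [div_le_one hw]; linarith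
  have hiwsq : 1 / w ^ 2 ≤ 1 / v ^ 2 := one_div_le_one_div_of_le (by positivity) (by gcongr)
  have e : 4 * saddleBracket w - (2 * Real.log v - 9 / (4 * Real.pi) * (Real.log v / v) +
      (6 / Real.pi + Real.pi / 4) * (1 / v)) = 2 * (Real.log w - Real.log v) -
      9 / (4 * Real.pi) * ((Real.log w - Real.log v) * (1 / w)) +
      9 / (4 * Real.pi) * (Real.log v * (1 / v - 1 / w)) -
      (6 / Real.pi + Real.pi / 4) * (1 / v - 1 / w) - 45 / 32 * (1 / w ^ 2) := by
    rw [saddleBracket]; field_simp; ring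
  have hc1 : 9 / (4 * Real.pi) ≤ 1 := by rw [div_le_one (by positivity)]; linarith
  have hc1' : 0 ≤ 9 / (4 * Real.pi) := by positivity
  have hc2 : 6 / Real.pi + Real.pi / 4 ≤ 3 := by
    have : 6 / Real.pi ≤ 2 := by rw [div_le_iff₀ (by positivity)]; linarith
    linarith
  have hc2' : 0 ≤ 6 / Real.pi + Real.pi / 4 := by positivity
  have b1 : 0 ≤ 9 / (4 * Real.pi) * ((Real.log w - Real.log v) * (1 / w)) :=
    mul_nonneg hc1' (mul_nonneg (by linarith) hiw.le)
  have b1' : 9 / (4 * Real.pi) * ((Real.log w - Real.log v) * (1 / w)) ≤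
      1 * ((1 / v ^ 2 / 16) * 1) := by
    have := sub_nonneg.2 hlog0
    gcongr
  have b2 : 0 ≤ 9 / (4 * Real.pi) * (Real.log v * (1 / v - 1 / w)) :=
    mul_nonneg hc1' (mul_nonneg hlv (by linarith))
  have b2' : 9 / (4 * Real.pi) * (Real.log v * (1 / v - 1 / w)) ≤
      1 * (Real.log v * (1 / v ^ 2 / 16)) := by
    have := sub_nonneg.2 hinv0
    gcongr
  have b3 : 0 ≤ (6 / Real.pi + Real.pi / 4) * (1 / v - 1 / w) :=
    mul_nonneg hc2' (by linarith)
  have b3' : (6 / Real.pi + Real.pi / 4) * (1 / v - 1 / w) ≤ 3 * (1 / v ^ 2 / 16) := by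
    have := sub_nonneg.2 hinv0
    gcongr
  have hprod : 0 ≤ Real.log v * (1 / v ^ 2) := by positivity
  have e2 : (7 + Real.log v) / v ^ 2 = 7 * (1 / v ^ 2) + Real.log v * (1 / v ^ 2) := by ring
  have hiw2 : 0 < 1 / w ^ 2 := by positivity
  rw [e, e2, abs_le]
  constructor <;> linarith

/-- The two corrections combined: the ratio of the prefactors times the bracket at `w` is the
bracket of the theorem at `v`. -/
lemma abs_ratio_mul_sub_le (hv : 3 ≤ v) (hw : 0 < w) (hvw : w ^ 2 = v ^ 2 + 1 / 8) {B δ : ℝ}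
    (hB : |B - saddleBracket w| ≤ δ) :
    |v * Real.sqrt v / (w * Real.sqrt w) * Real.exp (Real.pi * (w - v) / 3) * (4 * B) -
      (2 * Real.log v + (Real.pi / 6 - 9 / Real.pi) * (2 * Real.log v / (8 * v)) +
        (Real.pi / 4 + 6 / Real.pi) * (1 / v))| ≤ 50 * (Real.log v / v ^ 2) + 8 * δ := by
  have hpi := Real.pi_gt_three
  have hpi4 := Real.pi_lt_d2
  have hR := abs_prefactor_ratio_sub_le (by linarith) hw hvw
  have hS := abs_saddleBracket_sub_le (by linarith) hw hvw
  have hv0 : 0 < v := by linarith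
  have hl : 1 ≤ Real.log v := by
    rw [Real.le_log_iff_exp_le hv0]
    have := Real.exp_one_lt_d9
    linarith
  set R := v * Real.sqrt v / (w * Real.sqrt w) * Real.exp (Real.pi * (w - v) / 3)
  set M := 2 * Real.log v - 9 / (4 * Real.pi) * (Real.log v / v) +
      (6 / Real.pi + Real.pi / 4) * (1 / v) with hM
  set p := Real.pi / (48 * v) with hp
  have hiv : 1 / v ≤ 1 / 3 := one_div_le_one_div_of_le (by norm_num) hv
  have hiv0 : 0 < 1 / v := by positivity
  have hvsq : 0 < 1 / v ^ 2 := by positivity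
  have hivsq : 1 / v ^ 2 ≤ 1 / 9 := one_div_le_one_div_of_le (by norm_num) (by nlinarith)
  have hc1 : 9 / (4 * Real.pi) ≤ 1 := by rw [div_le_one (by positivity)]; linarith
  have hc1' : 0 ≤ 9 / (4 * Real.pi) := by positivity
  have hc2 : 6 / Real.pi + Real.pi / 4 ≤ 3 := by
    have : 6 / Real.pi ≤ 2 := by rw [div_le_iff₀ (by positivity)]; linarith
    linarith
  have hc2' : 0 ≤ 6 / Real.pi + Real.pi / 4 := by positivity
  have hpv : p = Real.pi / 48 * (1 / v) := by rw [hp]; field_simp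
  have hp1 : p ≤ 1 / 10 := by rw [hpv]; nlinarith
  have hp0 : 0 ≤ p := by rw [hp]; positivity
  have e4 : 4 / v ^ 2 = 4 * (1 / v ^ 2) := by ring
  rw [e4] at hR
  have hR2 : |R| ≤ 2 := by
    have := abs_le.1 hR
    rw [abs_le]; constructor <;> linarith
  have q1 : 9 / (4 * Real.pi) * (Real.log v / v) ≤ Real.log v := by
    have : Real.log v / v ≤ Real.log v := div_le_self (by linarith) (by linarith)
    have h0 : 0 ≤ Real.log v / v := by positivity
    calc _ ≤ 1 * (Real.log v / v) := by gcongr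
      _ ≤ _ := by linarith
  have q1' : 0 ≤ 9 / (4 * Real.pi) * (Real.log v / v) := by positivity
  have q2 : (6 / Real.pi + Real.pi / 4) * (1 / v) ≤ 3 * (1 / 3) := by gcongr
  have q2' : 0 ≤ (6 / Real.pi + Real.pi / 4) * (1 / v) := by positivity
  have hM2 : |M| ≤ 3 * Real.log v := by
    rw [abs_le, hM]; constructor <;> linarith
  set T := 2 * Real.log v + (Real.pi / 6 - 9 / Real.pi) * (2 * Real.log v / (8 * v)) +
        (Real.pi / 4 + 6 / Real.pi) * (1 / v) with hT
  have hMT : (1 + p) * M - T = Real.pi / 48 * (1 / v ^ 2) *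
      (-(9 / (4 * Real.pi) * Real.log v) + (6 / Real.pi + Real.pi / 4)) := by
    rw [hM, hT, hp]; field_simp; ring
  have hMT2 : |(1 + p) * M - T| ≤ 1 / v ^ 2 * (4 * Real.log v) := by
    rw [hMT, abs_mul, abs_of_pos (by positivity)]
    have hin : |(-(9 / (4 * Real.pi) * Real.log v) + (6 / Real.pi + Real.pi / 4))| ≤
        4 * Real.log v := by
      have : 9 / (4 * Real.pi) * Real.log v ≤ 1 * Real.log v := by gcongr
      have : 0 ≤ 9 / (4 * Real.pi) * Real.log v := by positivity
      rw [abs_le]; constructor <;> linarith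
    have : Real.pi / 48 * (1 / v ^ 2) ≤ 1 / v ^ 2 := by nlinarith
    gcongr
  have hid : R * (4 * B) - T = R * (4 * (B - saddleBracket w)) + R * (4 * saddleBracket w - M) +
      (R - (1 + p)) * M + ((1 + p) * M - T) := by ring
  have k1 : |R * (4 * (B - saddleBracket w))| ≤ 2 * (4 * δ) := by
    rw [abs_mul R, abs_mul 4, abs_of_pos (by norm_num : (0 : ℝ) < 4)]
    gcongr
  have k2 : |R * (4 * saddleBracket w - M)| ≤ 2 * ((7 + Real.log v) / v ^ 2) := by
    rw [abs_mul]
    gcongr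
  have k3 : |(R - (1 + p)) * M| ≤ 4 * (1 / v ^ 2) * (3 * Real.log v) := by
    rw [abs_mul]
    gcongr
  rw [hid]
  refine (abs_add_le _ _).trans ((add_le_add ((abs_add_le _ _).trans
    (add_le_add (abs_add_le _ _) le_rfl)) le_rfl).trans ?_)
  have e7 : (7 + Real.log v) / v ^ 2 = 7 * (1 / v ^ 2) + Real.log v * (1 / v ^ 2) := by ring
  have e5 : Real.log v / v ^ 2 = Real.log v * (1 / v ^ 2) := by ring
  have hmono : 1 * (1 / v ^ 2) ≤ Real.log v * (1 / v ^ 2) := by gcongr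
  rw [e7] at k2
  rw [e5]
  linarith

end Shift

lemma prefactor_eq {x : ℝ} (hx : 0 < x) :
    Real.exp (Real.pi * Real.sqrt (x / 3)) / (16 * (3 : ℝ) ^ (1 / 4 : ℝ) * x ^ (3 / 4 : ℝ)) =
      Real.sqrt 3 / (16 * (Real.sqrt (3 * x) * Real.sqrt (Real.sqrt (3 * x)))) *
        Real.exp (Real.pi * Real.sqrt (3 * x) / 3) := by
  have h1 : Real.sqrt (x / 3) = Real.sqrt (3 * x) / 3 := by
    rw [show x / 3 = 3 * x / 3 ^ 2 by ring, Real.sqrt_div' _ (by norm_num),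
      Real.sqrt_sq (by norm_num)]
  have h3x : 0 < 3 * x := by positivity
  have h2 : Real.sqrt (3 * x) * Real.sqrt (Real.sqrt (3 * x)) =
      Real.sqrt 3 * ((3 : ℝ) ^ (1 / 4 : ℝ) * x ^ (3 / 4 : ℝ)) := by
    simp only [Real.sqrt_eq_rpow]
    rw [← Real.rpow_mul h3x.le, ← Real.rpow_add h3x, Real.mul_rpow (by norm_num) hx.le,
      ← mul_assoc, ← Real.rpow_add (by norm_num)]
    norm_num
  have h4 : 0 < Real.sqrt 3 := by positivity
  rw [h1, h2, ← mul_div_assoc Real.pi]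
  field_simp

theorem corollary1p2 :
    ∃ E : ℕ → ℝ,
      (E =O[atTop] fun n : ℕ => Real.log (n : ℝ) / (n : ℝ)) ∧
      ∀ n : ℕ, 1 ≤ n →
        s1 n =
          Real.exp (Real.pi * Real.sqrt ((n : ℝ) / 3)) /
              (16 * (3 : ℝ) ^ (1 / 4 : ℝ) * (n : ℝ) ^ (3 / 4 : ℝ)) *
            (Real.log (3 * (n : ℝ))
              + (Real.pi / 6 - 9 / Real.pi) *
                  (Real.log (3 * (n : ℝ)) / (8 * Real.sqrt (3 * (n : ℝ))))
              + (Real.pi / 4 + 6 / Real.pi) * (1 / Real.sqrt (3 * (n : ℝ)))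
              + E n) := by
  let v : ℕ → ℝ := fun n => Real.sqrt (3 * n)
  let w : ℕ → ℝ := fun n => Real.sqrt (3 * (n + 1 / 24))
  let pre : ℕ → ℝ := fun n =>
    Real.sqrt 3 / (16 * (v n * Real.sqrt (v n))) * Real.exp (Real.pi * v n / 3)
  let T : ℕ → ℝ := fun n => Real.log (3 * (n : ℝ)) + (Real.pi / 6 - 9 / Real.pi) *
    (Real.log (3 * (n : ℝ)) / (8 * Real.sqrt (3 * (n : ℝ)))) +
      (Real.pi / 4 + 6 / Real.pi) * (1 / Real.sqrt (3 * (n : ℝ)))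
  refine ⟨fun n => s1 n / pre n - T n, ?_, ?_⟩
  · have hw_tendsto : Tendsto w atTop atTop := by
      refine Real.tendsto_sqrt_atTop.comp (Tendsto.const_mul_atTop (by norm_num) ?_)
      exact tendsto_atTop_add_const_right _ _ tendsto_natCast_atTop_atTop
    obtain ⟨C, hC0, hC⟩ := (saddleError_isBigO.comp_tendsto hw_tendsto).exists_pos
    refine IsBigO.of_bound (50 + 8 * (C * 2)) ?_
    filter_upwards [hC.bound, eventually_ge_atTop 3,
      hw_tendsto.eventually_ge_atTop (10 * Real.pi)] with n hn hn3 hwn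
    have hn3' : (3 : ℝ) ≤ n := by exact_mod_cast hn3
    have hn0 : (0 : ℝ) < n := by linarith
    have hv2 : v n ^ 2 = 3 * n := Real.sq_sqrt (by positivity)
    have hw2 : w n ^ 2 = 3 * (n + 1 / 24) := Real.sq_sqrt (by positivity)
    have hv3 : 3 ≤ v n := Real.le_sqrt_of_sq_le (by nlinarith)
    have hv0 : 0 < v n := by linarith
    have hw0 : 0 < w n := Real.sqrt_pos.2 (by positivity)
    have hvw : w n ^ 2 = v n ^ 2 + 1 / 8 := by rw [hv2, hw2]; ring
    have hlogv : Real.log (3 * n) = 2 * Real.log (v n) := by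
      rw [← hv2, Real.log_pow]; push_cast; ring
    have hlogn : Real.log (v n) ≤ Real.log n := by
      have : Real.log (3 * n) ≤ Real.log ((n : ℝ) * n) :=
        Real.log_le_log (by positivity) (by gcongr)
      rw [Real.log_mul hn0.ne' hn0.ne'] at this
      linarith
    have hlogn0 : 0 ≤ Real.log n := Real.log_nonneg (by linarith)
    have hB := abs_s1_div_sub_saddleBracket_le n hwn hw2
    have hmain := abs_ratio_mul_sub_le hv3 hw0 hvw hB
    have hratio : v n * Real.sqrt (v n) / (w n * Real.sqrt (w n)) *
        Real.exp (Real.pi * (w n - v n) / 3) * (4 * (s1 n / (Real.sqrt 3 /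
          (4 * (w n * Real.sqrt (w n))) * Real.exp (Real.pi * w n / 3)))) = s1 n / pre n := by
      have e : Real.exp (Real.pi * w n / 3) =
          Real.exp (Real.pi * (w n - v n) / 3) * Real.exp (Real.pi * v n / 3) := by
        rw [← Real.exp_add]; congr 1; ring
      have hsv := Real.sqrt_pos.2 hv0
      have hsw := Real.sqrt_pos.2 hw0
      have hs3 : 0 < Real.sqrt 3 := by positivity
      simp only [pre]
      rw [e]
      field_simp
      ring
    rw [hratio, ← hlogv] at hmain
    have hE1 : saddleError (w n) ≤ C * (2 * (Real.log n / n)) := by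
      have h1 : saddleError (w n) ≤ C * (Real.log (w n) / w n ^ 2) := by
        refine (Real.le_norm_self _).trans (hn.trans (le_of_eq ?_))
        have : 0 ≤ Real.log (w n) := Real.log_nonneg (by linarith [Real.pi_gt_three])
        simp only [Function.comp]
        rw [Real.norm_of_nonneg (by positivity)]
      refine h1.trans ?_
      have hlw : Real.log (w n) ≤ 2 * Real.log n := by
        have h2 : Real.log (w n ^ 2) ≤ Real.log ((n : ℝ) ^ 4) := by
          refine Real.log_le_log (by positivity) ?_
          rw [hw2]
          have : (27 : ℝ) ≤ n ^ 3 := by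
            calc (27 : ℝ) = 3 ^ 3 := by norm_num
              _ ≤ _ := by gcongr
          nlinarith
        rw [Real.log_pow, Real.log_pow] at h2
        push_cast at h2
        linarith
      have hwn2 : (n : ℝ) ≤ w n ^ 2 := by rw [hw2]; linarith
      calc C * (Real.log (w n) / w n ^ 2) ≤ C * (2 * Real.log n / n) := by gcongr
        _ = _ := by ring
    have hE2 : Real.log (v n) / v n ^ 2 ≤ Real.log n / n := by
      have : (n : ℝ) ≤ v n ^ 2 := by rw [hv2]; linarith
      gcongr
    rw [Real.norm_eq_abs, Real.norm_of_nonneg (by positivity)]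
    have hm : |s1 n / pre n - T n| ≤
        50 * (Real.log (v n) / v n ^ 2) + 8 * saddleError (w n) := hmain
    refine hm.trans ?_
    linarith
  · intro n hn
    have hn0 : (0 : ℝ) < n := by exact_mod_cast hn
    rw [prefactor_eq hn0]
    have hv0 : 0 < v n := Real.sqrt_pos.2 (by positivity)
    have hpre : pre n ≠ 0 := by
      have := Real.sqrt_pos.2 hv0
      have : 0 < Real.sqrt 3 := by positivity
      simp only [pre]
      positivity
    change s1 n = pre n * (T n + (s1 n / pre n - T n))
    field_simp
    ring
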